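/- \textbf{Definitions.} A constrained workflow authorization schema $W=(S,U,\leqslant,A,C)$ consists of a finite poset $(S,\leqslant)$ of steps, a finite set $U$ of users, an authorization relation $A\subseteq S\times U$ such that every step has at least one authorized user, and a finite set $C$ of constraints. In an instance of $\mathrm{WSP}_2(\neq)$ every constraint has the form $(\neq,S',S'')$ with $S',S''\subseteq S$ and at least one of $S',S''$ a singleton. A plan $\pi:S\to U$ satisfies this constraint if $\pi(s')\neq\pi(s'')$ for some $s'\in S'$, $s''\in S''$. A plan is valid if $(s,\pi(s))\in A$ for all $s\in S$ and it satisfies every constraint in $C$. Solving the problem means returning a valid plan, or the answer that no valid plan exists. The Exponential Time Hypothesis states that there is a real $\epsilon>0$ such that 3-SAT (satisfiability of a finite set of clauses, each with one, two or three literals, over $n$ variables) cannot be solved in time $O(2^{\epsilon n})$. Algorithms are deterministic Turing machines, and time is the number of steps. $\widetilde O(T)$ stands for $O(T\log^d T)$ with any constant $d$. \textbf{Theorem.} Assume the Exponential Time Hypothesis. Then there is a real $\epsilon>0$ such that $\mathrm{WSP}_2(\neq)$, even restricted to instances with exactly two users, cannot be solved in time $\widetilde O(2^{\epsilon k})$,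 where $k=|S|$ is the number of steps. This remains true if a further factor polynomial in the size of the instance is allowed: for no constants $C>0$ and $d,e\in\mathbb N$ does there exist an algorithm that solves each two-user instance, of size $N$ and with $k$ steps, within $C\,2^{\epsilon k}\,(1+\log 2^{\epsilon k})^d\,N^{e}$ steps. -/

import Mathlib

/-! ### Running time of algorithms

Algorithms are Mathlib's deterministic multi-stack Turing machines `Turing.FinTM2`, with binary
input and output; the running time is the number of machine steps. -/

/-- There is one Turing machine that, on the encoding of every instance `a`, halts after at most
`time a` steps with an output that is a correct answer for `a`. -/
def SolvableWithin {α : Type} (encode : α → List Bool) (correct : α → List Bool → Prop)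
    (time : α → ℝ) : Prop :=
  ∃ M : Turing.TM2ComputableAux Bool Bool, ∀ a : α, ∃ (out : List Bool) (t : ℕ),
    correct a out ∧ (t : ℝ) ≤ time a ∧
      Nonempty (Turing.TM2OutputsInTime M.tm ((encode a).map M.inputAlphabet.symm)
        (some (out.map M.outputAlphabet.symm)) t)

/-! ### Binary encodings -/

/-- Self-delimiting unary code of a natural number. -/
def encNat (n : ℕ) : List Bool := List.replicate n true ++ [false]

/-- Code of a list: every entry is announced by `true`, the end of the list by `false`. -/
def encList {α : Type} (enc : α → List Bool) (l : List α) : List Bool :=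
  l.flatMap (fun x => true :: enc x) ++ [false]

/-- The bit vector of a subset of `Fin k`. -/
def encSet {k : ℕ} (s : Finset (Fin k)) : List Bool := List.ofFn fun i => decide (i ∈ s)

/-- The bits of a Boolean matrix, row by row. -/
def encMatrix {p q : ℕ} (r : Fin p → Fin q → Bool) : List Bool :=
  (List.ofFn fun i => List.ofFn fun j => r i j).flatten

/-! ### 3-SAT and the Exponential Time Hypothesis -/

/-- A literal over `n` variables: `(v, true)` is the variable `v`, `(v, false)` its negation. -/
abbrev Literal (n : ℕ) := Fin n × Bool

/-- A clause `u ∨ v ∨ w`. Literals may be repeated, so shorter clauses are included. -/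
abbrev Clause (n : ℕ) := Fin 3 → Literal n

/-- A 3-CNF formula: a number of variables and a set of clauses, listed without repetition.
(Hence the size of a formula is polynomial in the number of variables.) -/
structure CNF3 where
  numVars : ℕ
  clauses : List (Clause numVars)
  nodup : clauses.Nodup

namespace CNF3

/-- Some truth assignment makes at least one literal of each clause true. -/
def Satisfiable (φ : CNF3) : Prop :=
  ∃ τ : Fin φ.numVars → Bool, ∀ c ∈ φ.clauses, ∃ i, τ (c i).1 = (c i).2

def encode (φ : CNF3) : List Bool :=
  encNat φ.numVars ++
    encList (fun c => (List.ofFn fun i => encNat (c i).1 ++ [(c i).2]).flatten) φ.clauses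

/-- The correct answer to the question whether `φ` is satisfiable: `1` for yes and `0` for no. -/
def Correct (φ : CNF3) (out : List Bool) : Prop :=
  (φ.Satisfiable ∧ out = [true]) ∨ (¬ φ.Satisfiable ∧ out = [false])

end CNF3

/-- The Exponential Time Hypothesis: there is a real `ε > 0` such that 3-SAT cannot be solved in
time `O(2 ^ (ε n))`, where `n` is the number of variables. -/
def ExponentialTimeHypothesis : Prop :=
  ∃ ε : ℝ, 0 < ε ∧ ∀ C : ℝ,
    ¬ SolvableWithin CNF3.encode CNF3.Correct fun φ => C * (2 : ℝ) ^ (ε * (φ.numVars : ℝ))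

/-! ### The workflow satisfiability problem -/

/-- An entailment constraint `(ρ, S', S'')` for `k` steps and `n` users. -/
@[ext]
structure Entailment (k n : ℕ) where
  rel : Fin n → Fin n → Bool
  left : Finset (Fin k)
  right : Finset (Fin k)

namespace Entailment

variable {k n : ℕ}

/-- A plan satisfies `(ρ, S', S'')` if `(π s', π s'') ∈ ρ` for some `s' ∈ S'` and `s'' ∈ S''`. -/
def SatisfiedBy (γ : Entailment k n) (π : Fin k → Fin n) : Prop :=
  ∃ s ∈ γ.left, ∃ s' ∈ γ.right, γ.rel (π s) (π s') = true

/-- The relation of the constraint is `≠`. -/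
def IsNe (γ : Entailment k n) : Prop := ∀ u v, γ.rel u v = true ↔ u ≠ v

/-- Constraints of Type at most 2: at least one of the two sets of steps is a singleton. -/
def IsType2 (γ : Entailment k n) : Prop := γ.left.card = 1 ∨ γ.right.card = 1

def encode (γ : Entailment k n) : List Bool :=
  encMatrix γ.rel ++ encSet γ.left ++ encSet γ.right

end Entailment

/-- A constrained workflow authorization schema `(S, U, ≤, A, C)` with entailment constraints:
a finite poset of steps, a finite set of users, an authorization relation under which every step
has an authorized user, and a set of constraints, listed without repetition. -/
structure Workflow where
  numSteps : ℕ
  numUsers : ℕ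
  le : Fin numSteps → Fin numSteps → Bool
  le_refl : ∀ s, le s s = true
  le_antisymm : ∀ s t, le s t = true → le t s = true → s = t
  le_trans : ∀ s t r, le s t = true → le t r = true → le s r = true
  auth : Fin numSteps → Fin numUsers → Bool
  exists_auth : ∀ s, ∃ u, auth s u = true
  constraints : List (Entailment numSteps numUsers)
  nodup : constraints.Nodup

namespace Workflow

/-- A plan is valid if it is authorized and satisfies all constraints. -/
def Valid (W : Workflow) (π : Fin W.numSteps → Fin W.numUsers) : Prop :=
  (∀ s, W.auth s (π s) = true) ∧ ∀ γ ∈ W.constraints, γ.SatisfiedBy π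

def encode (W : Workflow) : List Bool :=
  encNat W.numSteps ++ encNat W.numUsers ++ encMatrix W.le ++ encMatrix W.auth ++
    encList Entailment.encode W.constraints

/-- The correct answers: `1` followed by a valid plan, listed step by step, or `0` if there is no
valid plan. -/
def Correct (W : Workflow) (out : List Bool) : Prop :=
  (∃ π, W.Valid π ∧ out = true :: (List.ofFn fun s => encNat (π s)).flatten) ∨
    ((¬ ∃ π, W.Valid π) ∧ out = [false])

/-- The instances of `WSP₂(≠)` with exactly two users. -/
def IsTwoUserWSP2Ne (W : Workflow) : Prop :=
  W.numUsers = 2 ∧ ∀ γ ∈ W.constraints, γ.IsNe ∧ γ.IsType2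

end Workflow

/-- `WSP₂(≠)` restricted to two users (no behaviour is required on other inputs) can be solved in
the given time. -/
def TwoUserWSP2NeSolvableWithin (time : Workflow → ℝ) : Prop :=
  SolvableWithin (α := {W : Workflow // W.IsTwoUserWSP2Ne})
    (fun W => W.1.encode) (fun W => W.1.Correct) (fun W => time W.1)

/-! The lower bound comes from a reduction from 3-SAT whose number of steps is linear in the number
`n` of variables and does not depend on the number of clauses, so no sparsification is needed. With
two users, a plan is a 2-colouring of the steps. Each variable gets a path of six steps joined by
`≠`; the colours alternate along it, so even positions act as three copies of the variable and odd
positions as three copies of its negation. One extra step marks the colour "false", and a clause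
says that this step differs in colour from one of its literals, which is a single constraint with a
singleton on one side. This equivalence is `CNF3.exists_valid_iff`. The `p`-th literal of a clause
uses the `p`-th copy, so distinct clauses give distinct constraints and the bit vector of a clause
can be written while reading its literals from left to right.

There are `6 * n + 1` steps, and since clauses are not repeated the workflow has size `O(n ^ 4)`. A
solver with exponent `δ / 12` per step therefore decides 3-SAT in `2 ^ (δ n / 2)` times a polynomial
in `n`, up to a constant, and the remaining half of `δ` absorbs the polynomial
(`pow_le_mul_two_rpow`).

Since the model is a concrete Turing machine, the reduction has to be executed by one. Programs over
stacks of bits get a timed semantics, `Runs.reachesIn` compiles them, and `redMachine_outputs`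
chains a program with an arbitrary solver. `exec_workflowProg` verifies a program that prints the
workflow, using the explicit bit string of `encode_toWorkflow`. -/

/-! ### Stack programs

A small structured language for stack machines with a step-counting semantics. Programs are
compiled to `Turing.TM2` code that may share a machine with the code of another machine. -/

section StackMachines

open Turing Function

/-- `f` leads from `a` to `b` in exactly `t` steps. -/
def ReachesIn {C : Type} (f : C → Option C) (a : C) (t : ℕ) (b : C) : Prop :=
  (flip bind f)^[t] (some a) = some b

namespace ReachesIn

variable {C : Type} {f : C → Option C} {a b c : C} {t u : ℕ}

theorem refl (f : C → Option C) (a : C) : ReachesIn f a 0 a := rfl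

theorem of_step (h : f a = some b) : ReachesIn f a 1 b := h

theorem trans (h₁ : ReachesIn f a t b) (h₂ : ReachesIn f b u c) : ReachesIn f a (t + u) c := by
  unfold ReachesIn at *
  rw [add_comm, iterate_add_apply, h₁, h₂]

theorem succ_iff : ReachesIn f a (t + 1) b ↔ ∃ c, f a = some c ∧ ReachesIn f c t b := by
  have key : ∀ t : ℕ, (flip bind f)^[t] none = none := fun t => iterate_fixed rfl t
  unfold ReachesIn
  rw [iterate_succ_apply]
  change (flip bind f)^[t] (f a) = some b ↔ _
  cases h : f a with
  | none => rw [key]; simp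
  | some c => simp

end ReachesIn

/-- Programs acting on stacks of bits that are indexed by `K`. -/
inductive StackProg (K : Type) : Type
  | skip : StackProg K
  | push (k : K) (b : Bool) : StackProg K
  | seq (p q : StackProg K) : StackProg K
  /-- Pop a bit from `k` and continue with `p`, `q` or `r` according as the stack was empty,
  the bit is `false`, or the bit is `true`. -/
  | case (k : K) (p q r : StackProg K) : StackProg K
  /-- Pop a bit from `k`; as long as it is `true`, run `p` and repeat. -/
  | loop (k : K) (p : StackProg K) : StackProg K

namespace StackProg

variable {K : Type}

/-- `Runs p s t s'`: started on the stacks `s`, the program `p` ends on the stacks `s'` after at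
most `t` steps. -/
inductive Runs [DecidableEq K] :
    StackProg K → (K → List Bool) → ℕ → (K → List Bool) → Prop
  | skip {s} : Runs skip s 0 s
  | push {k b s} : Runs (push k b) s 1 (update s k (b :: s k))
  | seq {p q s t s' u s''} (hp : Runs p s t s') (hq : Runs q s' u s'') :
      Runs (seq p q) s (t + u) s''
  | case_nil {k p q r s t s'} (hk : s k = []) (hp : Runs p s t s') :
      Runs (case k p q r) s (1 + t) s'
  | case_false {k p q r s l t s'} (hk : s k = false :: l) (hq : Runs q (update s k l) t s') :
      Runs (case k p q r) s (1 + t) s'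
  | case_true {k p q r s l t s'} (hk : s k = true :: l) (hr : Runs r (update s k l) t s') :
      Runs (case k p q r) s (1 + t) s'
  | loop_nil {k p s} (hk : s k = []) : Runs (loop k p) s 1 s
  | loop_false {k p s l} (hk : s k = false :: l) : Runs (loop k p) s 1 (update s k l)
  | loop_true {k p s l t s' u s''} (hk : s k = true :: l) (hp : Runs p (update s k l) t s')
      (hl : Runs (loop k p) s' u s'') : Runs (loop k p) s (1 + t + u) s''
  | mono {p s t s' u} (h : Runs p s t s') (htu : t ≤ u) : Runs p s u s'

/-- The labels of the machine code of a program. -/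
def Label : StackProg K → Type
  | skip => Empty
  | push _ _ => Unit
  | seq p q => p.Label ⊕ q.Label
  | case _ p q r => Option (p.Label ⊕ q.Label ⊕ r.Label)
  | loop _ p => Option p.Label

instance fintypeLabel : (p : StackProg K) → Fintype p.Label
  | skip => inferInstanceAs (Fintype Empty)
  | push _ _ => inferInstanceAs (Fintype Unit)
  | seq p q =>
    have := fintypeLabel p
    have := fintypeLabel q
    inferInstanceAs (Fintype (p.Label ⊕ q.Label))
  | case _ p q r =>
    have := fintypeLabel p
    have := fintypeLabel q
    have := fintypeLabel r
    inferInstanceAs (Fintype (Option (p.Label ⊕ q.Label ⊕ r.Label)))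
  | loop _ p =>
    have := fintypeLabel p
    inferInstanceAs (Fintype (Option p.Label))

/-- The label at which the code of a program starts. -/
def entry {Λ : Type} : (p : StackProg K) → (p.Label → Λ) → Λ → Λ
  | skip, _, exit => exit
  | push _ _, emb, _ => emb ()
  | seq p q, emb, exit => p.entry (emb ∘ Sum.inl) (q.entry (emb ∘ Sum.inr) exit)
  | case _ _ _ _, emb, _ => emb none
  | loop _ _, emb, _ => emb none

/-! ### Compilation into a machine with additional stacks -/

/-- Stack alphabets of a machine that has stacks of bits next to the stacks of another machine. -/
abbrev JoinΓ (K : Type) {L : Type} (Γ : L → Type) : K ⊕ L → Type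
  | .inl _ => Bool
  | .inr l => Γ l

/-- The contents of all stacks of a joint machine. -/
def joinStk {L : Type} {Γ : L → Type} (s : K → List Bool) (S : ∀ l, List (Γ l)) :
    ∀ k, List (JoinΓ K Γ k)
  | .inl k => s k
  | .inr l => S l

section join

variable {L : Type} {Γ : L → Type} (s : K → List Bool) (S : ∀ l, List (Γ l))

@[simp] theorem joinStk_inl (k : K) : joinStk s S (.inl k) = s k := rfl

@[simp] theorem joinStk_inr (l : L) : joinStk s S (.inr l) = S l := rfl

variable [DecidableEq K] [DecidableEq L]

@[simp] theorem update_joinStk_inl (k : K) (x : List Bool) :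
    update (joinStk s S) (.inl k) x = joinStk (update s k x) S := by
  funext j
  rcases j with j | j
  · by_cases h : j = k
    · subst h; simp
    · have : (Sum.inl j : K ⊕ L) ≠ .inl k := by simpa using h
      simp [h, this]
  · simp

@[simp] theorem update_joinStk_inr (l : L) (x : List (Γ l)) :
    update (joinStk s S) (.inr l) x = joinStk s (update S l x) := by
  funext j
  rcases j with j | j
  · simp
  · by_cases h : j = l
    · subst h; simp
    · have : (Sum.inr j : K ⊕ L) ≠ .inr l := by simpa using h
      simp [h, this]

end join

section compile

variable {L : Type} {Γ : L → Type} {Λ τ : Type}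

/-- Forget the bit that was popped last, and jump. -/
def clearGoto (l : Λ) : TM2.Stmt (JoinΓ K Γ) Λ (τ × Option Bool) :=
  .load (fun v => (v.1, none)) (.goto fun _ => l)

/-- The machine code of a program. The second component of the internal state holds the bit that
was popped last; the first one belongs to the other machine. -/
def code : (p : StackProg K) → (p.Label → Λ) → Λ → p.Label →
    TM2.Stmt (JoinΓ K Γ) Λ (τ × Option Bool)
  | skip, _, _, l => nomatch l
  | push k b, _, exit, _ => .push (.inl k) (fun _ => b) (clearGoto exit)
  | seq p q, emb, exit, .inl l => p.code (emb ∘ .inl) (q.entry (emb ∘ .inr) exit) l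
  | seq _ q, emb, exit, .inr l => q.code (emb ∘ .inr) exit l
  | case k p q r, emb, exit, none =>
    .pop (.inl k) (fun v o => (v.1, o)) <|
      .branch (fun v => v.2.isNone)
        (clearGoto (p.entry (fun l => emb (some (.inl l))) exit)) <|
        .branch (fun v => v.2 == some true)
          (clearGoto (r.entry (fun l => emb (some (.inr (.inr l)))) exit))
          (clearGoto (q.entry (fun l => emb (some (.inr (.inl l)))) exit))
  | case _ p _ _, emb, exit, some (.inl l) => p.code (fun l => emb (some (.inl l))) exit l
  | case _ _ q _, emb, exit, some (.inr (.inl l)) =>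
    q.code (fun l => emb (some (.inr (.inl l)))) exit l
  | case _ _ _ r, emb, exit, some (.inr (.inr l)) =>
    r.code (fun l => emb (some (.inr (.inr l)))) exit l
  | loop k p, emb, exit, none =>
    .pop (.inl k) (fun v o => (v.1, o)) <|
      .branch (fun v => v.2 == some true)
        (clearGoto (p.entry (emb ∘ some) (emb none))) (clearGoto exit)
  | loop _ p, emb, _, some l => p.code (emb ∘ some) (emb none) l

variable [DecidableEq K] [DecidableEq L]

@[simp] theorem stepAux_clearGoto (l : Λ) (v : τ × Option Bool) (S : ∀ k, List (JoinΓ K Γ k)) :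
    TM2.stepAux (clearGoto l) v S = ⟨some l, (v.1, none), S⟩ := rfl

/-- Each push, test or loop check costs one machine step, so induction on the run works once the
exit label is general: the exit of a subprogram is the entry of its successor or the head of its
loop. `M` only has to agree with the code on the labels in the image of `emb`, which allows other
code to live beside it. -/
theorem Runs.reachesIn {p : StackProg K} {s s' : K → List Bool} {t : ℕ} (h : p.Runs s t s')
    (M : Λ → TM2.Stmt (JoinΓ K Γ) Λ (τ × Option Bool)) (emb : p.Label → Λ) (exit : Λ)
    (hM : ∀ l, M (emb l) = p.code emb exit l) (v : τ) (S : ∀ l, List (Γ l)) :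
    ∃ u ≤ t, ReachesIn (TM2.step M) ⟨some (p.entry emb exit), (v, none), joinStk s S⟩ u
      ⟨some exit, (v, none), joinStk s' S⟩ := by
  induction h generalizing exit with
  | skip => exact ⟨0, le_rfl, .refl _ _⟩
  | @push k b s =>
    refine ⟨1, le_rfl, .of_step ?_⟩
    refine (congrArg (fun q => some (TM2.stepAux q _ _)) (hM ())).trans ?_
    simp [code]
  | @seq p q s t s' u s'' _ _ ihp ihq =>
    obtain ⟨t', ht, hp⟩ := ihp (emb ∘ .inl) (q.entry (emb ∘ .inr) exit) fun l => hM (.inl l)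
    obtain ⟨u', hu, hq⟩ := ihq (emb ∘ .inr) exit fun l => hM (.inr l)
    exact ⟨t' + u', add_le_add ht hu, hp.trans hq⟩
  | @case_nil k p q r s t s' hk _ ih =>
    obtain ⟨t', ht, hp⟩ := ih (fun l => emb (some (.inl l))) exit fun l => hM (some (.inl l))
    refine ⟨1 + t', by lia, .trans (.of_step ?_) hp⟩
    have : update s k [] = s := by rw [← hk, update_eq_self]
    refine (congrArg (fun q => some (TM2.stepAux q _ _)) (hM none)).trans ?_
    simp [code, hk, this]
  | @case_false k p q r s l t s' hk _ ih =>
    obtain ⟨t', ht, hp⟩ := ih (fun l => emb (some (.inr (.inl l)))) exit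
      fun l => hM (some (.inr (.inl l)))
    refine ⟨1 + t', by lia, .trans (.of_step ?_) hp⟩
    refine (congrArg (fun q => some (TM2.stepAux q _ _)) (hM none)).trans ?_
    simp [code, hk]
  | @case_true k p q r s l t s' hk _ ih =>
    obtain ⟨t', ht, hp⟩ := ih (fun l => emb (some (.inr (.inr l)))) exit
      fun l => hM (some (.inr (.inr l)))
    refine ⟨1 + t', by lia, .trans (.of_step ?_) hp⟩
    refine (congrArg (fun q => some (TM2.stepAux q _ _)) (hM none)).trans ?_
    simp [code, hk]
  | @loop_nil k p s hk =>
    refine ⟨1, le_rfl, .of_step ?_⟩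
    have : update s k [] = s := by rw [← hk, update_eq_self]
    refine (congrArg (fun q => some (TM2.stepAux q _ _)) (hM none)).trans ?_
    simp [code, hk, this]
  | @loop_false k p s l hk =>
    refine ⟨1, le_rfl, .of_step ?_⟩
    refine (congrArg (fun q => some (TM2.stepAux q _ _)) (hM none)).trans ?_
    simp [code, hk]
  | @loop_true k p s l t s' u s'' hk _ _ ihp ihl =>
    obtain ⟨t', ht, hp⟩ := ihp (emb ∘ some) (emb none) fun l => hM (some l)
    obtain ⟨u', hu, hl⟩ := ihl emb exit hM
    refine ⟨1 + t' + u', by lia, .trans (.trans (.of_step ?_) hp) hl⟩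
    refine (congrArg (fun q => some (TM2.stepAux q _ _)) (hM none)).trans ?_
    simp [code, hk]
  | mono _ htu ih =>
    obtain ⟨t', ht, hp⟩ := ih emb exit hM
    exact ⟨t', ht.trans htu, hp⟩

end compile

end StackProg

/-! ### Many-one reductions computed by stack programs -/

open StackProg

theorem Turing.initList_eq (tm : FinTM2) (x : List (tm.Γ tm.k₀)) :
    initList tm x = ⟨some tm.main, tm.initialState, update (fun _ => []) tm.k₀ x⟩ := by
  unfold initList
  congr 1
  funext k
  by_cases h : k = tm.k₀
  · subst h; simp
  · simp [h]

theorem Turing.haltList_eq (tm : FinTM2) (x : List (tm.Γ tm.k₁)) :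
    haltList tm x = ⟨none, tm.initialState, update (fun _ => []) tm.k₁ x⟩ := by
  unfold haltList
  congr 1
  funext k
  by_cases h : k = tm.k₁
  · subst h; simp
  · simp [h]

namespace StackProg

variable {K : Type} [DecidableEq K]

/-- Labels of the part of `redMachine` that connects the preprocessing with the solver. -/
inductive Glue : Type
  | transfer
  | read
  | drain
  deriving DecidableEq

instance : Fintype Glue :=
  ⟨({Glue.transfer, Glue.read, Glue.drain} : Finset Glue), fun x => by cases x <;> simp⟩

section

variable (P : StackProg K) (inp out : K) (M : TM2ComputableAux Bool Bool)

/-- Labels of `redMachine`. -/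
abbrev RedLabel : Type := P.Label ⊕ M.tm.Λ ⊕ Glue

/-- The code of `M` inside `redMachine`: instead of halting, it jumps to `Glue.read`. -/
def embedStmt : TM2.Stmt M.tm.Γ M.tm.Λ M.tm.σ →
    TM2.Stmt (JoinΓ K M.tm.Γ) (RedLabel P M) (M.tm.σ × Option Bool)
  | .push l f q => .push (.inr l) (fun v => f v.1) (embedStmt q)
  | .peek l f q => .peek (.inr l) (fun v o => (f v.1 o, v.2)) (embedStmt q)
  | .pop l f q => .pop (.inr l) (fun v o => (f v.1 o, v.2)) (embedStmt q)
  | .load f q => .load (fun v => (f v.1, v.2)) (embedStmt q)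
  | .branch f q r => .branch (fun v => f v.1) (embedStmt q) (embedStmt r)
  | .goto f => .goto fun v => .inr (.inl (f v.1))
  | .halt => .goto fun _ => .inr (.inr .read)

/-- The code of `redMachine`. -/
def redCode : RedLabel P M → TM2.Stmt (JoinΓ K M.tm.Γ) (RedLabel P M) (M.tm.σ × Option Bool)
  | .inl l => P.code .inl (.inr (.inr .transfer)) l
  | .inr (.inl l) => embedStmt P M (M.tm.m l)
  | .inr (.inr .transfer) =>
    .pop (.inl out) (fun v o => (v.1, o)) <|
      .branch (fun v => v.2.isSome)
        (.push (.inr M.tm.k₀) (fun v => M.inputAlphabet.symm (v.2.getD false))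
          (clearGoto (.inr (.inr .transfer))))
        (clearGoto (.inr (.inl M.tm.main)))
  | .inr (.inr .read) =>
    .pop (.inr M.tm.k₁) (fun v o => (v.1, o.map M.outputAlphabet)) <|
      -- The default is harmless: the solver's output is nonempty wherever this code is analysed.
      .push (.inl inp) (fun v => v.2.getD false) (clearGoto (.inr (.inr .drain)))
  | .inr (.inr .drain) =>
    .pop (.inr M.tm.k₁) (fun v o => (v.1, o.map M.outputAlphabet)) <|
      .branch (fun v => v.2.isSome) (clearGoto (.inr (.inr .drain)))
        (.load (fun v => (v.1, none)) .halt)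

/-- The machine that runs `P`, then runs `M` on what `P` has written (in reverse) to the stack
`out`, and finally returns the first bit of the output of `M`. -/
def redMachine [Fintype K] : FinTM2 where
  K := K ⊕ M.tm.K
  kDecidableEq := inferInstance
  kFin := have := M.tm.kFin; inferInstance
  k₀ := .inl inp
  k₁ := .inl inp
  Γ := JoinΓ K M.tm.Γ
  Λ := RedLabel P M
  main := P.entry .inl (.inr (.inr .transfer))
  ΛFin := have := M.tm.ΛFin; inferInstance
  σ := M.tm.σ × Option Bool
  initialState := (M.tm.initialState, none)
  σFin := have := M.tm.σFin; inferInstance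
  Γk₀Fin := inferInstanceAs (Fintype Bool)
  m := redCode P inp out M

/-- A configuration of `M` as a configuration of `redMachine`. -/
def embedCfg (s : K → List Bool) (c : TM2.Cfg M.tm.Γ M.tm.Λ M.tm.σ) :
    TM2.Cfg (JoinΓ K M.tm.Γ) (RedLabel P M) (M.tm.σ × Option Bool) :=
  ⟨some (c.l.elim (.inr (.inr .read)) fun l => .inr (.inl l)), (c.var, none), joinStk s c.stk⟩

/-! ### Phases of the combined machine -/

variable {P inp out M}

theorem stepAux_embedStmt (q : TM2.Stmt M.tm.Γ M.tm.Λ M.tm.σ) (v : M.tm.σ)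
    (s : K → List Bool) (S : ∀ k, List (M.tm.Γ k)) :
    TM2.stepAux (embedStmt P M q) (v, none) (joinStk s S) =
      embedCfg P M s (TM2.stepAux q v S) := by
  induction q generalizing v S with
  | push l f q ih => simp [embedStmt, ih]
  | peek l f q ih => simp [embedStmt, ih]
  | pop l f q ih => simp [embedStmt, ih]
  | load f q ih => simp [embedStmt, ih]
  | branch f q r ihq ihr =>
    simp only [embedStmt, TM2.stepAux, ihq, ihr]
    cases f v <;> rfl
  | goto f => rfl
  | halt => rfl

/-- The simulation is step for step. A halted configuration of `M` becomes one at the label `read`,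
so halting is turned into a jump at no cost in time. -/
theorem reachesIn_embedCfg (s : K → List Bool) {t : ℕ} {a b : TM2.Cfg M.tm.Γ M.tm.Λ M.tm.σ}
    (h : ReachesIn (TM2.step M.tm.m) a t b) :
    ReachesIn (TM2.step (redCode P inp out M)) (embedCfg P M s a) t (embedCfg P M s b) := by
  induction t generalizing a with
  | zero =>
    obtain rfl : a = b := Option.some_injective _ h
    exact .refl _ _
  | succ t ih =>
    obtain ⟨c, hac, hcb⟩ := ReachesIn.succ_iff.1 h
    refine ReachesIn.succ_iff.2 ⟨_, ?_, ih hcb⟩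
    rcases a with ⟨_ | l, v, S⟩
    · simp at hac
    · obtain rfl : TM2.stepAux (M.tm.m l) v S = c := by simpa using hac
      exact congrArg some (stepAux_embedStmt _ _ _ _)

theorem reachesIn_transfer (s : K → List Bool) (S : ∀ k, List (M.tm.Γ k)) (v : M.tm.σ)
    (x : List Bool) (y : List (M.tm.Γ M.tm.k₀)) (hx : s out = x) (hy : S M.tm.k₀ = y) :
    ReachesIn (TM2.step (redCode P inp out M))
      ⟨some (.inr (.inr .transfer)), (v, none), joinStk s S⟩ (x.length + 1)
      ⟨some (.inr (.inl M.tm.main)), (v, none), joinStk (update s out [])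
        (update S M.tm.k₀ ((x.map M.inputAlphabet.symm).reverse ++ y))⟩ := by
  induction x generalizing s S y with
  | nil =>
    refine .of_step ?_
    simp [redCode, hx, ← hy]
  | cons b x ih =>
    refine ReachesIn.succ_iff.2 ⟨?_, ?_, ?_⟩
    rotate_left 2
    · convert ih (update s out x) (update S M.tm.k₀ (M.inputAlphabet.symm b :: y))
        (M.inputAlphabet.symm b :: y) (by simp) (by simp) using 2
      · rfl
      · rw [update_idem, update_idem]
        simp
    · simp [redCode, hx, hy]

theorem reachesIn_drain (s : K → List Bool) (S : ∀ k, List (M.tm.Γ k)) (v : M.tm.σ)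
    (x : List (M.tm.Γ M.tm.k₁)) (hx : S M.tm.k₁ = x) :
    ReachesIn (TM2.step (redCode P inp out M))
      ⟨some (.inr (.inr .drain)), (v, none), joinStk s S⟩ (x.length + 1)
      ⟨none, (v, none), joinStk s (update S M.tm.k₁ [])⟩ := by
  induction x generalizing S with
  | nil =>
    refine .of_step ?_
    simp [redCode, hx]
  | cons b x ih =>
    refine ReachesIn.succ_iff.2 ⟨?_, ?_, ?_⟩
    rotate_left 2
    · convert ih (update S M.tm.k₁ x) (by simp) using 2
      · rfl
      · rw [update_idem]
    · simp [redCode, hx]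

/-- Popping `out` and pushing onto the solver's input undoes the reversal of `y`. A halting
configuration must have the initial internal state and all stacks empty except the output stack;
this is why the rest `z` of the answer is drained and why `P` has to clean up after itself. -/
theorem redMachine_outputs [Fintype K] {x y z : List Bool} {b : Bool} {t u : ℕ}
    (hP : P.Runs (update (fun _ => []) inp x) t (update (fun _ => []) out y.reverse))
    (hM : Nonempty (TM2OutputsInTime M.tm (y.map M.inputAlphabet.symm)
      (some ((b :: z).map M.outputAlphabet.symm)) u)) :
    Nonempty (TM2OutputsInTime (redMachine P inp out M) x (some [b])
      (t + (y.length + 1) + u + 1 + (z.length + 1))) := by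
  obtain ⟨⟨u', hu'⟩, hu⟩ := hM
  obtain ⟨t', ht, h₁⟩ := hP.reachesIn (redCode P inp out M) .inl (.inr (.inr .transfer))
    (fun _ => rfl) M.tm.initialState (fun _ => [])
  have h₂ := reachesIn_transfer (P := P) (inp := inp) (out := out) (M := M)
    (update (fun _ => []) out y.reverse) (fun _ => []) M.tm.initialState y.reverse []
    (by simp) rfl
  have h₃ : ReachesIn (TM2.step M.tm.m) (initList M.tm (y.map M.inputAlphabet.symm)) u'
    (haltList M.tm ((b :: z).map M.outputAlphabet.symm)) := hu'
  rw [initList_eq, haltList_eq] at h₃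
  have h₄ := reachesIn_embedCfg (P := P) (inp := inp) (out := out) (fun _ => []) h₃
  have h₅ := reachesIn_drain (P := P) (inp := inp) (out := out) (M := M)
    (update (fun _ => []) inp [b])
    (update (fun _ => []) M.tm.k₁ (z.map M.outputAlphabet.symm)) M.tm.initialState _ (by simp; rfl)
  have h₆ : ReachesIn (TM2.step (redCode P inp out M))
      (embedCfg P M (fun _ => []) ⟨none, M.tm.initialState,
        update (fun _ => []) M.tm.k₁ ((b :: z).map M.outputAlphabet.symm)⟩) 1
      ⟨some (.inr (.inr .drain)), (M.tm.initialState, none),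
        joinStk (update (fun _ => []) inp [b])
          (update (fun _ => []) M.tm.k₁ (z.map M.outputAlphabet.symm))⟩ := by
    refine .of_step ?_
    simp [embedCfg, redCode]
  have e : (update (update (fun _ => []) out y.reverse) out [] : K → List Bool) = fun _ => [] := by
    simp
  rw [e] at h₂
  simp only [List.map_reverse, List.reverse_reverse, List.append_nil, List.length_reverse] at h₂
  have h := ((((h₁.trans h₂).trans h₄).trans h₆).trans h₅)
  refine ⟨⟨⟨t' + (y.length + 1) + u' + 1 + (z.length + 1), ?_⟩, ?_⟩⟩
  · have e (w : List Bool) : (update (fun _ => []) (Sum.inl inp) w :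
        ∀ k, List (JoinΓ K M.tm.Γ k)) = joinStk (update (fun _ => []) inp w) fun _ => [] := by
      rw [← update_joinStk_inl]
      congr 1
      funext k
      rcases k with k | k <;> rfl
    have hi : initList (redMachine P inp out M) x =
        ⟨some (P.entry .inl (.inr (.inr .transfer))), (M.tm.initialState, none),
          joinStk (update (fun _ => []) inp x) fun _ => []⟩ :=
      (initList_eq _ _).trans (congrArg (TM2.Cfg.mk _ _) (e x))
    have hh : haltList (redMachine P inp out M) [b] =
        ⟨none, (M.tm.initialState, none),
          joinStk (update (fun _ => []) inp [b]) fun _ => []⟩ :=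
      (haltList_eq _ _).trans (congrArg (TM2.Cfg.mk _ _) (e [b]))
    rw [update_idem, update_eq_self_iff.2 rfl, List.length_map] at h
    refine (congrArg (fun c => (flip bind (redMachine P inp out M).step)^[_] (some c)) hi).trans ?_
    exact Eq.trans h (congrArg some hh.symm)
  · have := hu
    simp only at this ⊢
    lia

end

end StackProg

/-- A reduction computed by a stack program, for problems whose answer is the first bit of every
answer to the reduced instance. -/
theorem SolvableWithin.of_reduction {α β K : Type} [DecidableEq K] [Fintype K]
    {encode : α → List Bool} {correct : α → List Bool → Prop}
    {encode' : β → List Bool} {correct' : β → List Bool → Prop} {time : β → ℝ}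
    (P : StackProg K) (inp out : K) (f : α → β) (steps len : α → ℕ)
    (hP : ∀ a, P.Runs (update (fun _ => []) inp (encode a)) (steps a)
      (update (fun _ => []) out (encode' (f a)).reverse))
    (hf : ∀ a x, correct' (f a) x → ∃ b z, x = b :: z ∧ z.length ≤ len a ∧ correct a [b])
    (h : SolvableWithin encode' correct' time) :
    SolvableWithin encode correct fun a =>
      steps a + (encode' (f a)).length + time (f a) + len a + 3 := by
  obtain ⟨M, hM⟩ := h
  refine ⟨⟨redMachine P inp out M, Equiv.refl Bool, Equiv.refl Bool⟩, fun a => ?_⟩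
  obtain ⟨x, t, hx, ht, hMt⟩ := hM (f a)
  obtain ⟨b, z, rfl, hz, hb⟩ := hf a x hx
  have e : (encode a).map (Equiv.refl Bool).symm = encode a := List.map_id _
  refine ⟨[b], _, hb, ?_, e.symm ▸ redMachine_outputs (hP a) hMt⟩
  have hz' : (z.length : ℝ) ≤ len a := by exact_mod_cast hz
  push_cast
  linarith

end StackMachines

/-! ### The workflow of a formula -/

namespace CNF3

section steps

variable {n : ℕ}

/-- The steps of the workflow other than the last one: there are three copies of each of the two
literals of the variable `v`, and `i / 2` is the number of the copy. -/
def nodeStep (v : Fin n) (i : Fin 6) : Fin (6 * n + 1) :=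
  ⟨2 * n * (i / 2) + 2 * v + i % 2, by fin_cases i <;> simp <;> omega⟩

/-- The step whose user stands for the truth value `false`. -/
def topStep (n : ℕ) : Fin (6 * n + 1) := Fin.last _

/-- Copy number `p` of a literal. -/
def literalStep (p : Fin 3) (l : Literal n) : Fin (6 * n + 1) :=
  nodeStep l.1 ⟨2 * p + if l.2 then 0 else 1, by split <;> omega⟩

theorem val_nodeStep (v : Fin n) (i : Fin 6) :
    (nodeStep v i : ℕ) = 2 * n * (i / 2) + 2 * v + i % 2 := rfl

theorem nodeStep_inj {v w : Fin n} {i j : Fin 6} :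
    nodeStep v i = nodeStep w j ↔ v = w ∧ i = j := by
  refine ⟨fun h => ?_, by rintro ⟨rfl, rfl⟩; rfl⟩
  have h' := congrArg Fin.val h
  rw [val_nodeStep, val_nodeStep] at h'
  have hv := v.2
  have hw := w.2
  fin_cases i <;> fin_cases j <;> simp [Fin.ext_iff] at h' ⊢ <;> omega

theorem nodeStep_ne_topStep (v : Fin n) (i : Fin 6) : nodeStep v i ≠ topStep n := by
  intro h
  have h' := congrArg Fin.val h
  rw [val_nodeStep] at h'
  have hv := v.2
  fin_cases i <;> simp [topStep] at h' <;> omega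

/-- The index `2 * p` or `2 * p + 1` records both the copy and the sign. -/
theorem literalStep_inj {p q : Fin 3} {l m : Literal n} :
    literalStep p l = literalStep q m ↔ p = q ∧ l = m := by
  rw [literalStep, literalStep, nodeStep_inj]
  rcases l with ⟨v, b⟩
  rcases m with ⟨w, c⟩
  cases b <;> cases c <;> simp [Fin.ext_iff, and_comm] <;> omega

/-- The constraint `(≠, s, t)`. -/
def neConstraint {k : ℕ} (s t : Finset (Fin k)) : Entailment k 2 := ⟨fun u v => u != v, s, t⟩

theorem neConstraint_satisfiedBy {k : ℕ} {s t : Finset (Fin k)} {π : Fin k → Fin 2} :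
    (neConstraint s t).SatisfiedBy π ↔ ∃ i ∈ s, ∃ j ∈ t, π i ≠ π j := by
  simp [Entailment.SatisfiedBy, neConstraint]

/-- Consecutive copies of literals of the same variable have different users. -/
def chainConstraint (v : Fin n) (i : Fin 5) : Entailment (6 * n + 1) 2 :=
  neConstraint {nodeStep v i.castSucc} {nodeStep v i.succ}

/-- Some literal of the clause has a user different from that of the last step. -/
def clauseConstraint (c : Clause n) : Entailment (6 * n + 1) 2 :=
  neConstraint {topStep n} (Finset.univ.image fun p => literalStep p (c p))

/-- A step in the set reveals the position of its literal as well as the literal, so the unordered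
set still determines the ordered clause. With a single copy, permuted clauses would collide and the
list of constraints could contain repetitions. -/
theorem clauseConstraint_injective : Function.Injective (clauseConstraint (n := n)) := by
  intro c d h
  have h' : (Finset.univ.image fun p => literalStep p (c p)) =
    Finset.univ.image fun p => literalStep p (d p) := congrArg Entailment.right h
  funext p
  have hp : literalStep p (c p) ∈ Finset.univ.image fun p => literalStep p (d p) :=
    h' ▸ Finset.mem_image_of_mem _ (Finset.mem_univ p)
  obtain ⟨q, -, hq⟩ := Finset.mem_image.1 hp
  obtain ⟨rfl, h⟩ := literalStep_inj.1 hq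
  exact h.symm

theorem chainConstraint_inj {v w : Fin n} {i j : Fin 5} :
    chainConstraint v i = chainConstraint w j ↔ v = w ∧ i = j := by
  refine ⟨fun h => ?_, by rintro ⟨rfl, rfl⟩; rfl⟩
  have h' : ({nodeStep v i.castSucc} : Finset _) = {nodeStep w j.castSucc} :=
    congrArg Entailment.left h
  simpa [nodeStep_inj] using h'

theorem chainConstraint_ne_clauseConstraint (v : Fin n) (i : Fin 5) (c : Clause n) :
    chainConstraint v i ≠ clauseConstraint c := by
  intro h
  have h' : ({nodeStep v i.castSucc} : Finset _) = {topStep n} := congrArg Entailment.left h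
  exact nodeStep_ne_topStep _ _ (Finset.singleton_injective h')

/-- All chain constraints. -/
def chainConstraints (n : ℕ) : List (Entailment (6 * n + 1) 2) :=
  (List.finRange n).flatMap fun v => (List.finRange 5).map (chainConstraint v)

theorem mem_chainConstraints {γ : Entailment (6 * n + 1) 2} :
    γ ∈ chainConstraints n ↔ ∃ v i, chainConstraint v i = γ := by
  simp [chainConstraints]

theorem nodup_chainConstraints (n : ℕ) : (chainConstraints n).Nodup := by
  refine List.nodup_flatMap.2 ⟨fun v _ => ?_, ?_⟩
  · exact (List.nodup_finRange 5).map fun i j h => (chainConstraint_inj.1 h).2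
  · refine (List.nodup_finRange n).imp fun {v w} hvw γ hv hw => hvw ?_
    obtain ⟨i, -, rfl⟩ := List.mem_map.1 hv
    obtain ⟨j, -, h⟩ := List.mem_map.1 hw
    exact (chainConstraint_inj.1 h).1.symm

end steps

/-- The workflow of a formula: users `0` and `1` are interchangeable, and a literal is true if its
copies are not performed by the user of the last step. -/
def toWorkflow (φ : CNF3) : Workflow where
  numSteps := 6 * φ.numVars + 1
  numUsers := 2
  le i j := i == j
  le_refl s := by simp
  le_antisymm s t h _ := by simpa using h
  le_trans s t r h h' := by simp_all
  auth _ _ := true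
  exists_auth _ := ⟨0, rfl⟩
  constraints := chainConstraints φ.numVars ++ φ.clauses.map clauseConstraint
  nodup := by
    refine List.nodup_append.2 ⟨nodup_chainConstraints _,
      φ.nodup.map clauseConstraint_injective, fun γ hγ δ hδ => ?_⟩
    obtain ⟨v, i, rfl⟩ := mem_chainConstraints.1 hγ
    obtain ⟨c, -, rfl⟩ := List.mem_map.1 hδ
    exact chainConstraint_ne_clauseConstraint v i c

/-! ### Valid plans and satisfying assignments -/

variable (φ : CNF3)

theorem toWorkflow_isTwoUserWSP2Ne : φ.toWorkflow.IsTwoUserWSP2Ne := by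
  refine ⟨rfl, fun γ hγ => ?_⟩
  rcases List.mem_append.1 hγ with h | h
  · obtain ⟨v, i, rfl⟩ := mem_chainConstraints.1 h
    exact ⟨fun u v => bne_iff_ne, Or.inl (Finset.card_singleton _)⟩
  · obtain ⟨c, -, rfl⟩ := List.mem_map.1 h
    exact ⟨fun u v => bne_iff_ne, Or.inl (Finset.card_singleton _)⟩

theorem toWorkflow_valid_iff (π : Fin (6 * φ.numVars + 1) → Fin 2) :
    φ.toWorkflow.Valid π ↔
      (∀ v (i : Fin 5), π (nodeStep v i.castSucc) ≠ π (nodeStep v i.succ)) ∧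
        ∀ c ∈ φ.clauses, ∃ p, π (topStep _) ≠ π (literalStep p (c p)) := by
  have h₁ (v : Fin φ.numVars) (i : Fin 5) : (chainConstraint v i).SatisfiedBy π ↔
      π (nodeStep v i.castSucc) ≠ π (nodeStep v i.succ) := by
    simp [chainConstraint, neConstraint_satisfiedBy]
  have h₂ (c : Clause φ.numVars) : (clauseConstraint c).SatisfiedBy π ↔
      ∃ p, π (topStep _) ≠ π (literalStep p (c p)) := by
    simp [clauseConstraint, neConstraint_satisfiedBy]
  constructor
  · rintro ⟨-, h⟩
    exact ⟨fun v i => (h₁ v i).1 (h _ (List.mem_append_left _ (mem_chainConstraints.2 ⟨v, i, rfl⟩))),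
      fun c hc => (h₂ c).1 (h _ (List.mem_append_right _ (List.mem_map_of_mem hc)))⟩
  · rintro ⟨hv, hc⟩
    refine ⟨fun _ => rfl, fun γ hγ => ?_⟩
    rcases List.mem_append.1 hγ with h | h
    · obtain ⟨v, i, rfl⟩ := mem_chainConstraints.1 h
      exact (h₁ v i).2 (hv v i)
    · obtain ⟨c, hc', rfl⟩ := List.mem_map.1 h
      exact (h₂ c).2 (hc c hc')

/-- With only two values, being different from the predecessor means switching, so parity decides.
-/
theorem eq_zero_iff_of_alternating {f : Fin 6 → Fin 2} (h : ∀ i : Fin 5, f i.castSucc ≠ f i.succ)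
    (i : Fin 6) : f i = f 0 ↔ (i : ℕ) % 2 = 0 := by
  have h0 : f 0 ≠ f 1 := h 0
  have h1 : f 1 ≠ f 2 := h 1
  have h2 : f 2 ≠ f 3 := h 2
  have h3 : f 3 ≠ f 4 := h 3
  have h4 : f 4 ≠ f 5 := h 4
  fin_cases i <;> simp <;> omega

theorem exists_valid_iff : (∃ π, φ.toWorkflow.Valid π) ↔ φ.Satisfiable := by
  constructor
  · rintro ⟨(π : Fin (6 * φ.numVars + 1) → Fin 2), hπ⟩
    obtain ⟨hv, hc⟩ := (φ.toWorkflow_valid_iff π).1 hπ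
    -- A variable is true when its first copy avoids the user of the top step.
    refine ⟨fun v => π (nodeStep v 0) != π (topStep _), fun c h => ?_⟩
    obtain ⟨p, hp⟩ := hc c h
    refine ⟨p, ?_⟩
    have key := eq_zero_iff_of_alternating (f := fun i => π (nodeStep (c p).1 i)) (hv (c p).1)
      ⟨2 * p + if (c p).2 then 0 else 1, by split <;> omega⟩
    change π (topStep _) ≠ π (nodeStep (c p).1 ⟨2 * p + if (c p).2 then 0 else 1, _⟩) at hp
    cases hb : (c p).2 <;> simp only [hb] at hp key ⊢
    -- A negative literal sits at an odd index, so its user differs from that of copy `0`. It also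
    -- differs from the top user, and there are only two users.
    · have : π (nodeStep (c p).1 0) = π (topStep _) := by
        simp at key hp
        omega
      simpa using this
    · have : π (nodeStep (c p).1 0) ≠ π (topStep _) := by
        simp at key hp
        omega
      simpa using this
  · rintro ⟨τ, hτ⟩
    classical
    -- User `1` performs the copies of true literals; user `0` performs those of false literals and
    -- the top step.
    let π : Fin (6 * φ.numVars + 1) → Fin 2 := fun s =>
      if ∃ v i, nodeStep v i = s ∧ (τ v = true ↔ (i : ℕ) % 2 = 0) then 1 else 0
    have hnode (v i) : π (nodeStep v i) = if (τ v = true ↔ (i : ℕ) % 2 = 0) then 1 else 0 := by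
      refine if_congr ⟨?_, fun h => ⟨v, i, rfl, h⟩⟩ rfl rfl
      rintro ⟨w, j, h, h'⟩
      obtain ⟨rfl, rfl⟩ := nodeStep_inj.1 h
      exact h'
    have htop : π (topStep _) = 0 := by
      refine if_neg ?_
      rintro ⟨w, j, h, -⟩
      exact nodeStep_ne_topStep w j h
    refine ⟨π, (φ.toWorkflow_valid_iff π).2 ⟨fun v i => ?_, fun c hc => ?_⟩⟩
    · rw [hnode, hnode]
      cases τ v <;> fin_cases i <;> simp
    · obtain ⟨p, hp⟩ := hτ c hc
      refine ⟨p, ?_⟩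
      rw [htop, literalStep, hnode, hp, if_pos]
      · exact zero_ne_one
      · simp only
        split <;> simp_all [Nat.add_mod]

/-- The first bit of a correct answer for the workflow is a correct answer for the formula. -/
theorem correct_of_correct_toWorkflow {x : List Bool} (hx : φ.toWorkflow.Correct x) :
    ∃ b z, x = b :: z ∧ z.length ≤ 2 * (6 * φ.numVars + 1) ∧ φ.Correct [b] := by
  rcases hx with ⟨(π : Fin (6 * φ.numVars + 1) → Fin 2), hπ, rfl⟩ | ⟨h, rfl⟩
  · refine ⟨true, _, rfl, ?_, Or.inl ⟨φ.exists_valid_iff.1 ⟨π, hπ⟩, rfl⟩⟩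
    change (List.ofFn fun s : Fin (6 * φ.numVars + 1) => encNat (π s)).flatten.length ≤ _
    rw [List.length_flatten, List.map_ofFn]
    -- A user is `0` or `1`, so its unary code has at most two bits.
    refine (List.sum_le_card_nsmul _ 2 fun l hl => ?_).trans (by simp [mul_comm])
    obtain ⟨s, rfl⟩ := List.mem_ofFn.1 hl
    have := (π s).2
    simp [encNat]
    omega
  · exact ⟨false, [], rfl, by simp, Or.inr ⟨fun h' => h (φ.exists_valid_iff.2 h'), rfl⟩⟩

/-! ### The encoding of the workflow of a formula -/

/-- `2 * n` bits, all of them `false` except that those at `2 * v` and `2 * v + 1` are `x`, `y`. -/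
def block (n v : ℕ) (x y : Bool) : List Bool :=
  List.replicate (2 * v) false ++ [x, y] ++ List.replicate (2 * (n - 1 - v)) false

theorem map_range_eq_block {n v : ℕ} (hv : v < n) (x y : Bool) {f : ℕ → Bool}
    (hf : ∀ j < 2 * n, f j = (x && j == 2 * v || y && j == 2 * v + 1)) :
    (List.range (2 * n)).map f = block n v x y := by
  refine List.ext_getElem (by simp [block]; omega) fun j hj _ => ?_
  rw [List.getElem_map, List.getElem_range, hf j (by simpa using hj)]
  simp only [block, List.append_assoc, List.cons_append, List.nil_append, List.getElem_append,
    List.getElem_cons, List.getElem_replicate, List.length_replicate]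
  split_ifs with h₁ h₂ h₃
  · have e₁ : j ≠ 2 * v := by omega
    have e₂ : j ≠ 2 * v + 1 := by omega
    simp [e₁, e₂]
  · have e : j = 2 * v := by omega
    simp [e]
  · have e : j = 2 * v + 1 := by omega
    simp [e]
  · have e₁ : j ≠ 2 * v := by omega
    have e₂ : j ≠ 2 * v + 1 := by omega
    simp [e₁, e₂]

theorem encSet_eq_map_range {k : ℕ} (s : Finset (Fin k)) (f : ℕ → Bool)
    (hf : ∀ i : Fin k, f i = decide (i ∈ s)) : encSet s = (List.range k).map f := by
  refine List.ext_getElem (by simp [encSet]) fun j hj _ => ?_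
  have : j < k := by simpa [encSet] using hj
  simp [encSet, ← hf ⟨j, this⟩]

theorem range_six_mul_add_one (n : ℕ) (f : ℕ → Bool) : (List.range (6 * n + 1)).map f =
    (List.range (2 * n)).map f ++ (List.range (2 * n)).map (fun j => f (2 * n + j)) ++
      (List.range (2 * n)).map (fun j => f (4 * n + j)) ++ [f (6 * n)] := by
  have : 6 * n + 1 = 2 * n + 2 * n + 2 * n + 1 := by ring
  rw [this, List.range_add, List.range_add, List.range_add]
  simp only [List.map_append, List.map_map, List.append_assoc]
  have h4 : 2 * n + 2 * n = 4 * n := by ring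
  have h6 : 4 * n + 2 * n = 6 * n := by ring
  simp [h4, h6, Function.comp_def]

/-- The bits of `{nodeStep v i}`. -/
def nodeBits (n v : ℕ) (i : Fin 6) : List Bool :=
  block n v (i == 0) (i == 1) ++ block n v (i == 2) (i == 3) ++
    block n v (i == 4) (i == 5) ++ [false]

/-- The bits of the set of literals of a clause. -/
def clauseBits {n : ℕ} (c : Clause n) : List Bool :=
  block n (c 0).1 (c 0).2 (!(c 0).2) ++ block n (c 1).1 (c 1).2 (!(c 1).2) ++
    block n (c 2).1 (c 2).2 (!(c 2).2) ++ [false]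

theorem encSet_singleton_nodeStep {n : ℕ} (v : Fin n) (i : Fin 6) :
    encSet {nodeStep v i} = nodeBits n v i := by
  rw [encSet_eq_map_range _ (fun j => j == (nodeStep v i : ℕ))
    (fun j => by simp [Fin.ext_iff, beq_eq_decide]), range_six_mul_add_one]
  have hv := v.2
  unfold nodeBits
  congr 1
  · congr 1
    · congr 1
      · refine map_range_eq_block hv _ _ fun j hj => ?_
        rw [val_nodeStep]
        fin_cases i <;> simp <;> omega
      · refine map_range_eq_block hv _ _ fun j hj => ?_
        rw [val_nodeStep]
        fin_cases i <;> simp <;> omega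
    · refine map_range_eq_block hv _ _ fun j hj => ?_
      rw [val_nodeStep]
      fin_cases i <;> simp <;> omega
  · rw [val_nodeStep]
    fin_cases i <;> simp <;> omega

theorem encSet_singleton_topStep (n : ℕ) :
    encSet {topStep n} = List.replicate (6 * n) false ++ [true] := by
  rw [encSet_eq_map_range _ (fun j => j == 6 * n)
    (fun j => by simp [topStep, Fin.ext_iff, beq_eq_decide]), List.range_succ, List.map_append]
  congr 1
  · refine List.eq_replicate_iff.2 ⟨by simp, fun b hb => ?_⟩
    simp at hb
    grind
  · simp

/-- The literal at position `p` affects block `p` only, because it uses copy `p`. Hence the blocks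
appear in the order in which the literals are read. -/
theorem encSet_clause {n : ℕ} (c : Clause n) :
    encSet (Finset.univ.image fun p => literalStep p (c p)) = clauseBits c := by
  have hval (p : Fin 3) : (literalStep p (c p) : ℕ) =
      2 * n * p + 2 * (c p).1 + if (c p).2 then 0 else 1 := by
    have : (2 * p + if (c p).2 then 0 else 1 : ℕ) / 2 = p ∧
        (2 * p + if (c p).2 then 0 else 1 : ℕ) % 2 = if (c p).2 then 0 else 1 := by
      split <;> omega
    rw [literalStep, val_nodeStep, this.1, this.2]
  have hex (j : ℕ) : (∃ p, (literalStep p (c p) : ℕ) = j) ↔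
      2 * (c 0).1 + (if (c 0).2 then 0 else 1) = j ∨
        2 * n + 2 * (c 1).1 + (if (c 1).2 then 0 else 1) = j ∨
          4 * n + 2 * (c 2).1 + (if (c 2).2 then 0 else 1) = j := by
    simp only [hval, Fin.exists_fin_succ, IsEmpty.exists_iff]
    simp [show 2 * n * 2 = 4 * n by ring]
  rw [encSet_eq_map_range _ (fun j => decide (∃ p, (literalStep p (c p) : ℕ) = j))
    (fun j => by simp [Fin.ext_iff]), range_six_mul_add_one]
  have h0 := (c 0).1.2
  have h1 := (c 1).1.2
  have h2 := (c 2).1.2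
  have hs (p : Fin 3) : (if (c p).2 then 0 else 1) ≤ 1 := by split <;> simp
  have hs0 := hs 0
  have hs1 := hs 1
  have hs2 := hs 2
  simp only [hex]
  unfold clauseBits
  congr 1
  · congr 1
    · congr 1
      · refine map_range_eq_block h0 _ _ fun j hj => Bool.eq_iff_iff.2 ?_
        cases (c 0).2 <;> simp <;> omega
      · refine map_range_eq_block h1 _ _ fun j hj => Bool.eq_iff_iff.2 ?_
        cases (c 1).2 <;> simp <;> omega
    · refine map_range_eq_block h2 _ _ fun j hj => Bool.eq_iff_iff.2 ?_
      cases (c 2).2 <;> simp <;> omega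
  · simp only [List.cons.injEq, decide_eq_false_iff_not, and_true]
    omega

/-- Read row by row, consecutive diagonal entries are separated by `k + 1` zeros, so the matrix is a
periodic word and can be printed without tracking the row. -/
theorem encMatrix_diagonal (k : ℕ) :
    encMatrix (fun i j : Fin (k + 1) => i == j) =
      (List.replicate k (true :: List.replicate (k + 1) false)).flatten ++ [true] := by
  -- The `m` extra zeros are the start of row `m`; they complete the last period.
  have key (m : ℕ) (hm : m ≤ k) :
      ((List.range m).map fun i =>
        List.replicate i false ++ true :: List.replicate (k - i) false).flatten ++
          List.replicate m false =
        (List.replicate m (true :: List.replicate (k + 1) false)).flatten := by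
    induction m with
    | zero => simp
    | succ m ih =>
      have h : List.replicate (k + 1) false =
          List.replicate (k - m) false ++ List.replicate (m + 1) false := by
        rw [← List.replicate_add]
        congr 1
        omega
      rw [List.replicate_succ' (a := true :: _), List.flatten_append, ← ih (by omega), h,
        List.range_succ]
      simp
  rw [← key k le_rfl]
  have hrow (i : Fin (k + 1)) : (List.ofFn fun j => i == j) =
      List.replicate i false ++ true :: List.replicate (k - i) false := by
    refine List.ext_getElem (by simp; omega) fun j hj _ => ?_
    simp only [List.getElem_ofFn, List.getElem_append, List.getElem_cons, List.getElem_replicate,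
      List.length_replicate]
    split_ifs <;> simp [Fin.ext_iff] <;> omega
  have hrows : (List.ofFn fun i : Fin (k + 1) => List.ofFn fun j => i == j) =
      (List.range (k + 1)).map fun i =>
        List.replicate i false ++ true :: List.replicate (k - i) false := by
    refine List.ext_getElem (by simp) fun j hj _ => ?_
    simp only [List.getElem_ofFn, hrow, List.getElem_map, List.getElem_range]
  rw [encMatrix, hrows, List.range_succ]
  simp

theorem encMatrix_true (p q : ℕ) :
    encMatrix (fun (_ : Fin p) (_ : Fin q) => true) = List.replicate (p * q) true := by
  simp [encMatrix]

/-- The code of a constraint `(≠, s, t)`, given the bits of `s` and `t`. -/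
def neBits (s t : List Bool) : List Bool := [false, true, true, false] ++ s ++ t

theorem encode_neConstraint {k : ℕ} (s t : Finset (Fin k)) :
    (neConstraint s t).encode = neBits (encSet s) (encSet t) := by
  have : encMatrix (neConstraint s t).rel = [false, true, true, false] := by
    simp only [encMatrix, neConstraint]
    decide
  rw [Entailment.encode, this]
  rfl

theorem encode_chainConstraint {n : ℕ} (v : Fin n) (i : Fin 5) :
    (chainConstraint v i).encode = neBits (nodeBits n v i.castSucc) (nodeBits n v i.succ) := by
  rw [chainConstraint, encode_neConstraint, encSet_singleton_nodeStep, encSet_singleton_nodeStep]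

theorem encode_clauseConstraint {n : ℕ} (c : Clause n) :
    (clauseConstraint c).encode =
      neBits (List.replicate (6 * n) false ++ [true]) (clauseBits c) := by
  rw [clauseConstraint, encode_neConstraint, encSet_singleton_topStep, encSet_clause]

/-- The chain constraints of one variable, as they appear in the code of the workflow. -/
def chainBits (n v : ℕ) : List Bool :=
  (List.finRange 5).flatMap fun i => true :: neBits (nodeBits n v i.castSucc) (nodeBits n v i.succ)

/-- The first four-bit word ends the unary number of steps and encodes the two users. -/
theorem encode_toWorkflow : φ.toWorkflow.encode =
    List.replicate (6 * φ.numVars + 1) true ++ [false, true, true, false] ++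
      ((List.replicate (6 * φ.numVars)
        (true :: List.replicate (6 * φ.numVars + 1) false)).flatten ++ [true]) ++
      List.replicate ((6 * φ.numVars + 1) * 2) true ++
      (List.range φ.numVars).flatMap (chainBits φ.numVars) ++
      (φ.clauses.flatMap fun c =>
        true :: neBits (List.replicate (6 * φ.numVars) false ++ [true]) (clauseBits c)) ++
      [false] := by
  have h₁ : encMatrix φ.toWorkflow.le = _ := encMatrix_diagonal (6 * φ.numVars)
  have h₂ : encMatrix φ.toWorkflow.auth = _ := encMatrix_true (6 * φ.numVars + 1) 2
  have h₃ : (chainConstraints φ.numVars).flatMap (fun γ => true :: γ.encode) =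
      (List.range φ.numVars).flatMap (chainBits φ.numVars) := by
    rw [chainConstraints, ← List.map_coe_finRange_eq_range, List.flatMap_map, List.flatMap_assoc]
    simp only [List.flatMap_map, encode_chainConstraint]
    rfl
  have h₄ : φ.toWorkflow.constraints.flatMap (fun γ => true :: γ.encode) =
      (List.range φ.numVars).flatMap (chainBits φ.numVars) ++ φ.clauses.flatMap fun c =>
        true :: neBits (List.replicate (6 * φ.numVars) false ++ [true]) (clauseBits c) := by
    change (chainConstraints φ.numVars ++ φ.clauses.map clauseConstraint).flatMap
      (fun γ => true :: γ.encode) = _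
    rw [List.flatMap_append, h₃, List.flatMap_map]
    simp only [encode_clauseConstraint]
  unfold Workflow.encode encList
  rw [h₁, h₂, h₄]
  simp [encNat, toWorkflow, List.replicate_succ]

/-- The absence of repetitions is essential here: it bounds all sizes and running times of the
reduction in terms of the number of variables alone. -/
theorem length_clauses_le : φ.clauses.length ≤ (2 * φ.numVars) ^ 3 := by
  refine φ.nodup.length_le_card.trans (le_of_eq ?_)
  simp [mul_comm]

theorem length_block {n v : ℕ} (hv : v < n) (x y : Bool) : (block n v x y).length = 2 * n := by
  simp [block]
  omega

theorem length_nodeBits {n v : ℕ} (hv : v < n) (i : Fin 6) :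
    (nodeBits n v i).length = 6 * n + 1 := by
  simp [nodeBits, length_block hv]
  omega

theorem length_clauseBits {n : ℕ} (c : Clause n) : (clauseBits c).length = 6 * n + 1 := by
  simp [clauseBits, length_block (Fin.is_lt _)]
  omega

theorem length_encode_toWorkflow_le :
    φ.toWorkflow.encode.length ≤ 1000 * (φ.numVars + 1) ^ 4 := by
  have h₁ : ((List.range φ.numVars).flatMap (chainBits φ.numVars)).length =
      φ.numVars * (5 * (12 * φ.numVars + 7)) := by
    rw [List.length_flatMap]
    have : ∀ x ∈ (List.range φ.numVars).map fun v => (chainBits φ.numVars v).length,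
        x = 5 * (12 * φ.numVars + 7) := by
      intro x hx
      obtain ⟨v, hv, rfl⟩ := List.mem_map.1 hx
      simp [chainBits, neBits, length_nodeBits (List.mem_range.1 hv), List.length_flatMap]
      omega
    rw [List.eq_replicate_of_mem this]
    simp
  have h₂ : (φ.clauses.flatMap fun c => true :: neBits
      (List.replicate (6 * φ.numVars) false ++ [true]) (clauseBits c)).length =
      φ.clauses.length * (12 * φ.numVars + 7) := by
    rw [List.length_flatMap]
    simp [neBits, length_clauseBits]
    left
    omega
  rw [encode_toWorkflow]
  simp only [List.length_append, h₁, h₂]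
  have h₃ := Nat.mul_le_mul_right (12 * φ.numVars + 7) φ.length_clauses_le
  simp
  nlinarith [sq_nonneg φ.numVars]

end CNF3

/-! ### A stack program that writes the workflow of a formula -/

open StackProg

namespace CNF3

/-- The stacks of the program: the input, the output (in reverse), the number `n` of variables in
unary with a stack to keep it while counting, two counters for outer loops, and a variable number
in unary with a stack to keep it. -/
inductive Reg : Type
  | inp | out | cnt | cntTmp | outer₁ | outer₂ | var | varTmp
  deriving DecidableEq

instance : Fintype Reg :=
  ⟨({.inp, .out, .cnt, .cntTmp, .outer₁, .outer₂, .var, .varTmp} : Finset Reg),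
    fun x => by cases x <;> decide⟩

/-- The contents of the stacks. -/
structure Regs : Type where
  inp : List Bool
  out : List Bool
  cnt : List Bool
  cntTmp : List Bool
  outer₁ : List Bool
  outer₂ : List Bool
  var : List Bool
  varTmp : List Bool

namespace Regs

def get (s : Regs) : Reg → List Bool
  | .inp => s.inp
  | .out => s.out
  | .cnt => s.cnt
  | .cntTmp => s.cntTmp
  | .outer₁ => s.outer₁
  | .outer₂ => s.outer₂
  | .var => s.var
  | .varTmp => s.varTmp

def set (s : Regs) : Reg → List Bool → Regs
  | .inp, x => { s with inp := x }
  | .out, x => { s with out := x }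
  | .cnt, x => { s with cnt := x }
  | .cntTmp, x => { s with cntTmp := x }
  | .outer₁, x => { s with outer₁ := x }
  | .outer₂, x => { s with outer₂ := x }
  | .var, x => { s with var := x }
  | .varTmp, x => { s with varTmp := x }

/-- With record updates in place of function updates, concrete executions can be checked by `rfl`.
-/
theorem update_get (s : Regs) (r : Reg) (x : List Bool) :
    Function.update s.get r x = (s.set r x).get := by
  funext q
  cases r <;> cases q <;> rfl

end Regs

/-- `StackProg.Runs` for programs with stacks `Reg`. -/
def Exec (p : StackProg Reg) (s : Regs) (t : ℕ) (s' : Regs) : Prop := p.Runs s.get t s'.get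

namespace Exec

variable {p q r : StackProg Reg} {s s' s'' : Regs} {t u : ℕ} {k : Reg} {l : List Bool}

theorem mono (h : Exec p s t s') (htu : t ≤ u) : Exec p s u s' := Runs.mono h htu

theorem of_eq (h : Exec p s t s') (hs : s' = s'') (htu : t ≤ u) : Exec p s u s'' :=
  hs ▸ h.mono htu

theorem skip : Exec .skip s 0 s := Runs.skip

theorem push (k : Reg) (b : Bool) (s : Regs) : Exec (.push k b) s 1 (s.set k (b :: s.get k)) := by
  unfold Exec
  rw [← Regs.update_get]
  exact Runs.push

theorem seq (hp : Exec p s t s') (hq : Exec q s' u s'') : Exec (.seq p q) s (t + u) s'' :=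
  Runs.seq hp hq

theorem case_false (hk : s.get k = false :: l) (h : Exec q (s.set k l) t s') :
    Exec (.case k p q r) s (1 + t) s' :=
  Runs.case_false hk (by rw [Regs.update_get]; exact h)

theorem case_true (hk : s.get k = true :: l) (h : Exec r (s.set k l) t s') :
    Exec (.case k p q r) s (1 + t) s' :=
  Runs.case_true hk (by rw [Regs.update_get]; exact h)

theorem loop_nil (hk : s.get k = []) : Exec (.loop k p) s 1 s := Runs.loop_nil hk

theorem loop_false (hk : s.get k = false :: l) : Exec (.loop k p) s 1 (s.set k l) := by
  unfold Exec
  rw [← Regs.update_get]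
  exact Runs.loop_false hk

theorem loop_true (hk : s.get k = true :: l) (hp : Exec p (s.set k l) t s')
    (hl : Exec (.loop k p) s' u s'') : Exec (.loop k p) s (1 + t + u) s'' :=
  Runs.loop_true hk (by rw [Regs.update_get]; exact hp) hl

end Exec

/-! ### Writing words and counting in unary -/

/-- Append bits to the output. -/
def emit (w : List Bool) : StackProg Reg := w.foldr (fun b p => .seq (.push .out b) p) .skip

theorem exec_emit (w : List Bool) (s : Regs) :
    Exec (emit w) s w.length { s with out := w.reverse ++ s.out } := by
  induction w generalizing s with
  | nil => exact Exec.skip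
  | cons b w ih =>
    refine ((Exec.push .out b s).seq (ih _)).of_eq ?_ (by simp [add_comm])
    simp [Regs.set, Regs.get]

/-- `Emits n v p t w`: if the number of variables is `n` and the current variable is `v`, then the
program `p` appends `w` to the output in at most `t` steps. -/
def Emits (n v : ℕ) (p : StackProg Reg) (t : ℕ) (w : List Bool) : Prop :=
  ∀ i o e f, Exec p ⟨i, o, .replicate n true, [], e, f, .replicate v true, []⟩ t
    ⟨i, w.reverse ++ o, .replicate n true, [], e, f, .replicate v true, []⟩

namespace Emits

variable {n v t u : ℕ} {p q : StackProg Reg} {w x : List Bool}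

theorem mono (h : Emits n v p t w) (htu : t ≤ u) : Emits n v p u w :=
  fun i o e f => (h i o e f).mono htu

theorem seq (hp : Emits n v p t w) (hq : Emits n v q u x) :
    Emits n v (.seq p q) (t + u) (w ++ x) := by
  intro i o e f
  simpa using (hp i o e f).seq (hq i _ e f)

theorem emit (n v : ℕ) (w : List Bool) : Emits n v (emit w) w.length w :=
  fun _ _ _ _ => exec_emit w _

end Emits

/-- Run a list of programs one after the other. -/
def seqs (l : List (StackProg Reg)) : StackProg Reg := l.foldr .seq .skip

theorem Emits.seqs {α : Type} {n v t : ℕ} {g : α → StackProg Reg} {w : α → List Bool}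
    (h : ∀ a, Emits n v (g a) t (w a)) (l : List α) :
    Emits n v (CNF3.seqs (l.map g)) (l.length * t) (l.flatMap w) := by
  induction l with
  | nil => exact fun _ _ _ _ => Exec.skip.mono (by simp)
  | cons a l ih =>
    refine ((h a).seq ih).mono ?_
    rw [List.length_cons]
    lia

/-- Restore the number of variables after it has been used as a counter. -/
abbrev restoreCnt : StackProg Reg := .loop .cntTmp (.push .cnt true)

theorem exec_restoreCnt (a m : ℕ) (i o e f v d : List Bool) :
    Exec restoreCnt ⟨i, o, .replicate a true, .replicate m true, e, f, v, d⟩ (m * 2 + 1)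
      ⟨i, o, .replicate (a + m) true, [], e, f, v, d⟩ := by
  induction m generalizing a with
  | zero => exact Exec.loop_nil rfl
  | succ m ih =>
    refine (Exec.loop_true rfl (Exec.push _ _ _) (ih (a + 1))).of_eq ?_ (by lia)
    rw [add_assoc, add_comm 1]

theorem exec_restoreVar (a m : ℕ) (i o c c' e f : List Bool) :
    Exec (.loop .varTmp (.push .var true))
      ⟨i, o, c, c', e, f, .replicate a true, .replicate m true⟩ (m * 2 + 1)
      ⟨i, o, c, c', e, f, .replicate (a + m) true, []⟩ := by
  induction m generalizing a with
  | zero => exact Exec.loop_nil rfl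
  | succ m ih =>
    refine (Exec.loop_true rfl (Exec.push _ _ _) (ih (a + 1))).of_eq ?_ (by lia)
    rw [add_assoc, add_comm 1]

/-- Append `w` to the output, as many times as the counter tells. -/
def forCnt (w : List Bool) : StackProg Reg :=
  .seq (.loop .cnt (.seq (.push .cntTmp true) (emit w))) restoreCnt

/-- The program may start with `n` marks already set aside on `cntTmp`; these are restored too.
`blockProg` relies on this to finish a block with a partly used counter. -/
theorem exec_forCnt (w : List Bool) (m n : ℕ) (i o e f v d : List Bool) :
    Exec (forCnt w) ⟨i, o, .replicate m true, .replicate n true, e, f, v, d⟩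
      (m * (w.length + 4) + n * 2 + 2)
      ⟨i, (List.replicate m w).flatten.reverse ++ o, .replicate (n + m) true, [], e, f, v, d⟩ := by
  have h : Exec (.loop .cnt (.seq (.push .cntTmp true) (emit w)))
      ⟨i, o, .replicate m true, .replicate n true, e, f, v, d⟩ (m * (w.length + 2) + 1)
      ⟨i, (List.replicate m w).flatten.reverse ++ o, [], .replicate (n + m) true, e, f, v, d⟩ := by
    induction m generalizing o n with
    | zero => exact (Exec.loop_nil rfl).mono (by simp)
    | succ m ih =>
      refine (Exec.loop_true rfl ((Exec.push _ _ _).seq (exec_emit w _))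
        (ih (n + 1) (w.reverse ++ o))).of_eq ?_ (by lia)
      rw [add_assoc, add_comm 1]
      simp [List.replicate_succ]
  refine (h.seq (exec_restoreCnt 0 _ _ _ _ _ _ _)).of_eq ?_ (by lia)
  rw [zero_add]

theorem emits_forCnt (n v : ℕ) (w : List Bool) :
    Emits n v (forCnt w) (n * (w.length + 4) + 2) (List.replicate n w).flatten := by
  intro i o e f
  refine (exec_forCnt w n 0 i o e f _ []).of_eq ?_ (by lia)
  rw [zero_add]

theorem flatten_replicate_replicate {α : Type} (m k : ℕ) (a : α) :
    (List.replicate m (List.replicate k a)).flatten = List.replicate (m * k) a := by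
  simp

/-- Write `CNF3.block n v x y` for the current variable `v`. -/
def blockProg (x y : Bool) : StackProg Reg :=
  .seq (.loop .var (.seq (.push .varTmp true) (.case .cnt .skip .skip
    (.seq (.push .cntTmp true) (emit [false, false]))))) <|
  .seq (.loop .varTmp (.push .var true)) <|
  .seq (.case .cnt .skip .skip (.seq (.push .cntTmp true) (emit [x, y])))
    (forCnt [false, false])

/-- Every mark of `var` uses up one mark of `cnt` and writes two zeros, so what is left on `cnt`
measures the rest of the block. -/
theorem exec_skipVar (m v a : ℕ) (i o e f : List Bool) :
    Exec (.loop .var (.seq (.push .varTmp true) (.case .cnt .skip .skip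
        (.seq (.push .cntTmp true) (emit [false, false])))))
      ⟨i, o, .replicate (m + v) true, .replicate a true, e, f,
        .replicate v true, .replicate a true⟩ (v * 6 + 1)
      ⟨i, .replicate (2 * v) false ++ o, .replicate m true, .replicate (a + v) true, e, f, [],
        .replicate (a + v) true⟩ := by
  induction v generalizing a o with
  | zero => exact (Exec.loop_nil rfl).of_eq (by simp) (by simp)
  | succ v ih =>
    refine (Exec.loop_true rfl ((Exec.push _ _ _).seq (Exec.case_true (l := .replicate (m + v) true)
      rfl ((Exec.push _ _ _).seq (exec_emit [false, false] _))))
        (ih (a + 1) ([false, false] ++ o))).of_eq ?_ (by simp; lia)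
    rw [add_assoc a, add_comm 1, mul_add, List.replicate_add (m := 2 * v)]
    simp

theorem emits_blockProg {n v : ℕ} (hv : v < n) (x y : Bool) :
    Emits n v (blockProg x y) (20 * (n + 1)) (block n v x y) := by
  intro i o e f
  -- The counter splits into `v` pairs before, the pair `x, y` itself, and `m` pairs after. Thus
  -- `cnt` is nonempty at every `case`, and the `skip` branches are not taken.
  obtain ⟨m, rfl⟩ : ∃ m, n = m + 1 + v := ⟨n - 1 - v, by lia⟩
  refine ((exec_skipVar (m + 1) v 0 i o e f).seq ((exec_restoreVar 0 _ _ _ _ _ _ _).seq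
    ((Exec.case_true rfl ((Exec.push _ _ _).seq (exec_emit [x, y] _))).seq
      (exec_forCnt [false, false] m (0 + v + 1) _ _ _ _ _ _)))).of_eq ?_ (by simp; lia)
  have h₁ : 0 + v + 1 + m = m + 1 + v := by lia
  have h₂ : m + 1 + v - 1 - v = m := by lia
  rw [h₁, zero_add, block, h₂, show [false, false] = List.replicate 2 false from rfl,
    flatten_replicate_replicate, mul_comm m]
  simp [Regs.set, Regs.get]

/-! ### Writing the chain constraints and the order relation -/

/-- Write the bits of `{nodeStep v i}` for the current variable `v`. -/
def nodeProg (i : Fin 6) : StackProg Reg :=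
  .seq (.seq (.seq (blockProg (i == 0) (i == 1)) (blockProg (i == 2) (i == 3)))
    (blockProg (i == 4) (i == 5))) (emit [false])

theorem emits_nodeProg {n v : ℕ} (hv : v < n) (i : Fin 6) :
    Emits n v (nodeProg i) (61 * (n + 1)) (nodeBits n v i) :=
  ((((emits_blockProg hv _ _).seq (emits_blockProg hv _ _)).seq (emits_blockProg hv _ _)).seq
    (Emits.emit n v [false])).mono (by simp; lia)

/-- Write the chain constraints of the current variable. -/
def chainProg : StackProg Reg :=
  seqs ((List.finRange 5).map fun i =>
    .seq (emit [true, false, true, true, false]) (.seq (nodeProg i.castSucc) (nodeProg i.succ)))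

theorem emits_chainProg {n v : ℕ} (hv : v < n) :
    Emits n v chainProg (700 * (n + 1)) (chainBits n v) := by
  have e : chainBits n v = (List.finRange 5).flatMap fun i =>
      [true, false, true, true, false] ++ (nodeBits n v i.castSucc ++ nodeBits n v i.succ) := by
    simp [chainBits, neBits]
  rw [e]
  have h (i : Fin 5) : Emits n v
      (.seq (emit [true, false, true, true, false]) (.seq (nodeProg i.castSucc) (nodeProg i.succ)))
      (5 + 122 * (n + 1))
      ([true, false, true, true, false] ++ (nodeBits n v i.castSucc ++ nodeBits n v i.succ)) :=
    ((Emits.emit n v _).seq ((emits_nodeProg hv _).seq (emits_nodeProg hv _))).mono (by simp; lia)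
  exact (Emits.seqs h (List.finRange 5)).mono (by simp; lia)

/-- Write the chain constraints of all variables. -/
def chainsProg : StackProg Reg :=
  .seq (.loop .outer₂ (.seq chainProg (.push .var true))) (.loop .var .skip)

theorem exec_drainVar (v : ℕ) (i o c c' e f d : List Bool) :
    Exec (.loop .var .skip) ⟨i, o, c, c', e, f, .replicate v true, d⟩ (v + 1)
      ⟨i, o, c, c', e, f, [], d⟩ := by
  induction v with
  | zero => exact Exec.loop_nil rfl
  | succ v ih => exact (Exec.loop_true rfl Exec.skip ih).mono (by lia)

theorem exec_chainsProg (n : ℕ) (i o e : List Bool) :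
    Exec chainsProg ⟨i, o, .replicate n true, [], e, .replicate n true, [], []⟩
      (n * (700 * (n + 1) + 2) + n + 2)
      ⟨i, ((List.range n).flatMap (chainBits n)).reverse ++ o, .replicate n true, [], e, [], [],
        []⟩ := by
  -- Invariant: `outer₂` counts down while `var` counts up, with sum `n`.
  have h (m v : ℕ) (hm : m + v = n) (o : List Bool) :
      Exec (.loop .outer₂ (.seq chainProg (.push .var true)))
        ⟨i, o, .replicate n true, [], e, .replicate m true, .replicate v true, []⟩
        (m * (700 * (n + 1) + 2) + 1)
        ⟨i, ((List.range' v m).flatMap (chainBits n)).reverse ++ o, .replicate n true, [], e, [],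
          .replicate n true, []⟩ := by
    induction m generalizing v o with
    | zero =>
      obtain rfl : v = n := by lia
      exact (Exec.loop_nil rfl).mono (by simp)
    | succ m ih =>
      refine (Exec.loop_true rfl ((emits_chainProg (by lia : v < n) i o e _).seq
        (Exec.push _ _ _)) (ih (v + 1) (by lia) _)).of_eq ?_ (by lia)
      simp [List.range'_succ]
  refine ((h n 0 (by lia) o).seq (exec_drainVar n _ _ _ _ _ _ _)).of_eq ?_ (by lia)
  rw [List.range_eq_range']

/-- Write the bits of the identity matrix. -/
def diagonalProg : StackProg Reg :=
  .seq (.loop .outer₁ (seqs ((List.finRange 6).map fun _ =>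
    .seq (emit [true]) (.seq (forCnt (.replicate 6 false)) (emit [false]))))) (emit [true])

/-- The `6 * n` periods are written in `n` rounds of six, since only `n` is available in unary. -/
theorem exec_diagonalProg (n : ℕ) (i o f : List Bool) :
    Exec diagonalProg ⟨i, o, .replicate n true, [], .replicate n true, f, [], []⟩
      (n * (60 * (n + 1)) + 2)
      ⟨i, ((List.replicate (6 * n) (true :: List.replicate (6 * n + 1) false)).flatten ++
        [true]).reverse ++ o, .replicate n true, [], [], f, [], []⟩ := by
  set row := true :: List.replicate (6 * n + 1) false with hrow
  have hbody : Emits n 0 (seqs ((List.finRange 6).map fun _ =>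
      .seq (emit [true]) (.seq (forCnt (.replicate 6 false)) (emit [false]))))
      (60 * n + 30) (List.replicate 6 row).flatten := by
    have : Emits n 0 (.seq (emit [true]) (.seq (forCnt (.replicate 6 false)) (emit [false])))
        (10 * n + 5) row := by
      have := ((Emits.emit n 0 [true]).seq
        ((emits_forCnt n 0 (.replicate 6 false)).seq (Emits.emit n 0 [false]))).mono
          (by simp; lia : _ ≤ 10 * n + 5)
      rw [flatten_replicate_replicate, mul_comm n 6] at this
      rw [hrow, List.replicate_succ' (n := 6 * n)]
      exact this
    exact (Emits.seqs (fun _ => this) (List.finRange 6)).mono (by simp; lia)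
  have h (m : ℕ) (o : List Bool) :
      Exec (.loop .outer₁ (seqs ((List.finRange 6).map fun _ =>
        .seq (emit [true]) (.seq (forCnt (.replicate 6 false)) (emit [false])))))
        ⟨i, o, .replicate n true, [], .replicate m true, f, [], []⟩
        (m * (60 * n + 31) + 1)
        ⟨i, ((List.replicate (6 * m) row).flatten).reverse ++ o, .replicate n true, [], [], f, [],
          []⟩ := by
    induction m generalizing o with
    | zero => exact (Exec.loop_nil rfl).mono (by simp)
    | succ m ih =>
      refine (Exec.loop_true rfl (hbody i o _ f) (ih _)).of_eq ?_ (by lia)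
      rw [mul_add, mul_one, add_comm, List.replicate_add]
      simp
  refine ((h n o).seq (exec_emit [true] _)).of_eq ?_ ?_
  · simp
  · simp
    nlinarith

/-! ### Translating clauses -/

/-- Read a literal and write the corresponding block. -/
def literalProg : StackProg Reg :=
  .seq (.loop .inp (.push .var true))
    (.seq (.case .inp .skip (blockProg false true) (blockProg true false)) (.loop .var .skip))

theorem exec_literalProg {n v : ℕ} (hv : v < n) (b : Bool) (i o e f : List Bool) :
    Exec literalProg ⟨encNat v ++ b :: i, o, .replicate n true, [], e, f, [], []⟩ (25 * (n + 1))
      ⟨i, (block n v b (!b)).reverse ++ o, .replicate n true, [], e, f, [], []⟩ := by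
  have h (m a : ℕ) : Exec (.loop .inp (.push .var true))
      ⟨encNat m ++ b :: i, o, .replicate n true, [], e, f, .replicate a true, []⟩ (m * 2 + 1)
      ⟨b :: i, o, .replicate n true, [], e, f, .replicate (a + m) true, []⟩ := by
    induction m generalizing a with
    | zero => exact Exec.loop_false rfl
    | succ m ih =>
      refine (Exec.loop_true (l := encNat m ++ b :: i) rfl (Exec.push _ _ _) (ih (a + 1))).of_eq ?_
        (by lia)
      rw [add_assoc, add_comm 1]
  have h' : Exec (.case .inp .skip (blockProg false true) (blockProg true false))
      ⟨b :: i, o, .replicate n true, [], e, f, .replicate (0 + v) true, []⟩ (1 + 20 * (n + 1))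
      ⟨i, (block n v b (!b)).reverse ++ o, .replicate n true, [], e, f, .replicate v true, []⟩ := by
    rw [zero_add]
    cases b
    · exact Exec.case_false rfl (emits_blockProg hv _ _ _ _ _ _)
    · exact Exec.case_true rfl (emits_blockProg hv _ _ _ _ _ _)
  exact ((h v 0).seq (h'.seq (exec_drainVar v _ _ _ _ _ _ _))).mono (by lia)

/-- Read a clause and write the corresponding constraint. -/
def clauseProg : StackProg Reg :=
  .seq (.seq (.seq (emit [true, false, true, true, false]) (forCnt (.replicate 6 false)))
      (emit [true])) <|
    .seq literalProg <| .seq literalProg <| .seq literalProg (emit [false])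

/-- The code of a clause. -/
def encClause {n : ℕ} (c : Clause n) : List Bool :=
  (List.ofFn fun i => encNat (c i).1 ++ [(c i).2]).flatten

theorem exec_clauseProg {n : ℕ} (c : Clause n) (i o e f : List Bool) :
    Exec clauseProg ⟨encClause c ++ i, o, .replicate n true, [], e, f, [], []⟩ (90 * (n + 1))
      ⟨i, (true :: neBits (List.replicate (6 * n) false ++ [true]) (clauseBits c)).reverse ++ o,
        .replicate n true, [], e, f, [], []⟩ := by
  have hc : encClause c ++ i = encNat (c 0).1 ++ (c 0).2 :: (encNat (c 1).1 ++ (c 1).2 ::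
      (encNat (c 2).1 ++ (c 2).2 :: i)) := by
    simp [encClause, List.ofFn_succ]
  have h₁ := ((Emits.emit n 0 [true, false, true, true, false]).seq
    (emits_forCnt n 0 (.replicate 6 false))).seq (Emits.emit n 0 [true])
  rw [flatten_replicate_replicate, mul_comm n 6] at h₁
  rw [hc]
  refine ((h₁ _ o e f).seq ((exec_literalProg (c 0).1.2 _ _ _ e f).seq
    ((exec_literalProg (c 1).1.2 _ _ _ e f).seq ((exec_literalProg (c 2).1.2 _ _ _ e f).seq
      (exec_emit [false] _))))).of_eq ?_ (by simp; lia)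
  simp [neBits, clauseBits]

/-- The list code matches the loop: the bit `true` announcing a clause is the one that the loop test
pops, and the closing `false` ends the loop with empty input. -/
theorem exec_clausesProg {n : ℕ} (l : List (Clause n)) (o e f : List Bool) :
    Exec (.loop .inp clauseProg) ⟨encList encClause l, o, .replicate n true, [], e, f, [], []⟩
      (l.length * (90 * (n + 1) + 1) + 1)
      ⟨[], (l.flatMap fun c => true :: neBits (List.replicate (6 * n) false ++ [true])
        (clauseBits c)).reverse ++ o, .replicate n true, [], e, f, [], []⟩ := by
  induction l generalizing o with
  | nil => exact (Exec.loop_false rfl).mono (by simp)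
  | cons c l ih =>
    have : encList encClause (c :: l) = true :: (encClause c ++ encList encClause l) := by
      simp [encList]
    rw [this]
    refine (Exec.loop_true rfl (exec_clauseProg c _ o e f) (ih _)).of_eq ?_
      (by rw [List.length_cons]; lia)
    simp

/-! ### The complete translation -/

/-- Read the number of variables. -/
def readProg : StackProg Reg :=
  .loop .inp (.seq (.push .cnt true) (.seq (.push .outer₁ true) (.push .outer₂ true)))

theorem exec_readProg (n a : ℕ) (i o : List Bool) :
    Exec readProg ⟨encNat n ++ i, o, .replicate a true, [], .replicate a true, .replicate a true,
      [], []⟩ (n * 4 + 1) ⟨i, o, .replicate (a + n) true, [], .replicate (a + n) true,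
        .replicate (a + n) true, [], []⟩ := by
  unfold readProg
  induction n generalizing a with
  | zero => exact Exec.loop_false rfl
  | succ n ih =>
    refine (Exec.loop_true (l := encNat n ++ i) rfl ((Exec.push _ _ _).seq
      ((Exec.push _ _ _).seq (Exec.push _ _ _))) (ih (a + 1))).of_eq ?_ (by lia)
    rw [add_assoc, add_comm 1]

theorem exec_drainCnt (n : ℕ) (i o c' e f v d : List Bool) :
    Exec (.loop .cnt .skip) ⟨i, o, .replicate n true, c', e, f, v, d⟩ (n + 1)
      ⟨i, o, [], c', e, f, v, d⟩ := by
  induction n with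
  | zero => exact Exec.loop_nil rfl
  | succ v ih => exact (Exec.loop_true rfl Exec.skip ih).mono (by lia)

/-- Read a formula and write its workflow. -/
def workflowProg : StackProg Reg :=
  .seq readProg <|
  .seq (.seq (forCnt (.replicate 6 true)) (emit [true, false, true, true, false])) <|
  .seq diagonalProg <|
  .seq (.seq (forCnt (.replicate 12 true)) (emit [true, true])) <|
  .seq chainsProg <|
  .seq (.loop .inp clauseProg) <|
  .seq (emit [false]) (.loop .cnt .skip)

theorem exec_workflowProg (φ : CNF3) :
    Exec workflowProg ⟨φ.encode, [], [], [], [], [], [], []⟩ (2000 * (φ.numVars + 1) ^ 4)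
      ⟨[], φ.toWorkflow.encode.reverse, [], [], [], [], [], []⟩ := by
  have h₁ := (emits_forCnt φ.numVars 0 (.replicate 6 true)).seq
    (Emits.emit φ.numVars 0 [true, false, true, true, false])
  have h₂ := (emits_forCnt φ.numVars 0 (.replicate 12 true)).seq
    (Emits.emit φ.numVars 0 [true, true])
  rw [flatten_replicate_replicate] at h₁ h₂
  have h₀ := exec_readProg φ.numVars 0 (encList encClause φ.clauses) []
  rw [zero_add] at h₀
  refine (h₀.seq <| (h₁ _ _ _ _).seq <| (exec_diagonalProg _ _ _ _).seq <| (h₂ _ _ _ _).seq <|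
    (exec_chainsProg _ _ _ _).seq <| (exec_clausesProg _ _ _ _).seq <|
      (exec_emit [false] _).seq (exec_drainCnt _ _ _ _ _ _ _ _)).of_eq ?_ ?_
  · have e₁ : List.replicate (6 * φ.numVars + 1) true =
        List.replicate (φ.numVars * 6) true ++ [true] := by
      rw [mul_comm, List.replicate_succ']
    have e₂ : List.replicate ((6 * φ.numVars + 1) * 2) true =
        List.replicate (φ.numVars * 12) true ++ [true, true] := by
      rw [show (6 * φ.numVars + 1) * 2 = φ.numVars * 12 + 2 by ring, List.replicate_add]
      rfl
    rw [encode_toWorkflow, e₁, e₂]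
    simp
  · have h₃ := Nat.mul_le_mul_right (90 * (φ.numVars + 1) + 1) φ.length_clauses_le
    simp only [List.length_replicate, List.length_cons, List.length_nil]
    clear h₀ h₁ h₂
    generalize φ.clauses.length = m at *
    generalize φ.numVars = n at *
    -- The clauses dominate the running time; all other phases are at most quadratic in `n`.
    have h₄ : (2 * n) ^ 3 * (90 * (n + 1) + 1) = 720 * n ^ 4 + 728 * n ^ 3 := by ring
    have h₅ : (n + 1) ^ 4 = n ^ 4 + 4 * n ^ 3 + 6 * n ^ 2 + 4 * n + 1 := by ring
    rw [h₄] at h₃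
    rw [h₅]
    nlinarith [Nat.zero_le (n ^ 4), Nat.zero_le (n ^ 3)]

theorem runs_workflowProg (φ : CNF3) :
    workflowProg.Runs (Function.update (fun _ => []) .inp φ.encode) (2000 * (φ.numVars + 1) ^ 4)
      (Function.update (fun _ => []) .out φ.toWorkflow.encode.reverse) := by
  have h := φ.exec_workflowProg
  unfold Exec at h
  convert h using 1
  · funext r
    cases r <;> rfl
  · funext r
    cases r <;> rfl

end CNF3

/-! ### The lower bound -/

theorem SolvableWithin.mono {α : Type} {encode : α → List Bool} {correct : α → List Bool → Prop}
    {time time' : α → ℝ} (h : SolvableWithin encode correct time) (hle : ∀ a, time a ≤ time' a) :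
    SolvableWithin encode correct time' := by
  obtain ⟨M, hM⟩ := h
  refine ⟨M, fun a => ?_⟩
  obtain ⟨out, t, hout, ht, hMt⟩ := hM a
  exact ⟨out, t, hout, ht.trans (hle a), hMt⟩

/-- An algorithm for two-user `WSP₂(≠)` yields one for 3-SAT. -/
theorem TwoUserWSP2NeSolvableWithin.solvableWithin_cnf3 {time : Workflow → ℝ}
    (h : TwoUserWSP2NeSolvableWithin time) :
    SolvableWithin CNF3.encode CNF3.Correct fun φ =>
      3017 * ((φ.numVars : ℝ) + 1) ^ 4 + time φ.toWorkflow := by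
  have h' := SolvableWithin.of_reduction CNF3.workflowProg .inp .out
    (fun φ : CNF3 => (⟨φ.toWorkflow, φ.toWorkflow_isTwoUserWSP2Ne⟩ :
      {W : Workflow // W.IsTwoUserWSP2Ne})) _ _ CNF3.runs_workflowProg
    (fun φ _ hx => φ.correct_of_correct_toWorkflow hx) h
  -- The constant `3017` collects `2000` for running the program, `1000` for transferring the
  -- instance, and `17` for the discarded plan and the `3` extra steps.
  refine h'.mono fun φ => ?_
  have h₁ : (φ.toWorkflow.encode.length : ℝ) ≤ 1000 * ((φ.numVars : ℝ) + 1) ^ 4 := by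
    exact_mod_cast φ.length_encode_toWorkflow_le
  have h₂ : (φ.numVars : ℝ) + 1 ≤ ((φ.numVars : ℝ) + 1) ^ 4 :=
    le_self_pow₀ (by linarith [φ.numVars.cast_nonneg (α := ℝ)]) (by norm_num)
  have h₃ := φ.numVars.cast_nonneg (α := ℝ)
  push_cast
  linarith

/-- A single term of the exponential series, `y ^ D / D! ≤ exp y` at `y = a * log 2 * x`, gives the
explicit `B`. -/
theorem pow_le_mul_two_rpow {a : ℝ} (ha : 0 < a) (D : ℕ) :
    ∃ B : ℝ, 0 ≤ B ∧ ∀ x : ℝ, 0 ≤ x → x ^ D ≤ B * (2 : ℝ) ^ (a * x) := by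
  have hb : 0 < a * Real.log 2 := mul_pos ha (Real.log_pos one_lt_two)
  refine ⟨D.factorial / (a * Real.log 2) ^ D, by positivity, fun x hx => ?_⟩
  have h := Real.pow_div_factorial_le_exp (a * Real.log 2 * x) (by positivity) D
  have e : (2 : ℝ) ^ (a * x) = Real.exp (a * Real.log 2 * x) := by
    rw [Real.rpow_def_of_pos two_pos]
    ring_nf
  rw [div_le_iff₀ (by positivity), mul_pow] at h
  rw [e, div_mul_eq_mul_div, le_div_iff₀ (by positivity)]
  linarith

/-- Assuming the Exponential Time Hypothesis, there is `ε > 0` such that `WSP₂(≠)` with two users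
cannot be solved in time `Õ(T)`, where `T = 2 ^ (ε k)` and `k` is the number of steps, not even if
in addition an arbitrary factor polynomial in the size of the instance is allowed. -/
theorem theorem4 (hETH : ExponentialTimeHypothesis) :
    ∃ ε : ℝ, 0 < ε ∧ ∀ (C : ℝ) (d e : ℕ),
      ¬ TwoUserWSP2NeSolvableWithin fun W =>
        C * ((2 : ℝ) ^ (ε * (W.numSteps : ℝ)) *
            (1 + Real.log ((2 : ℝ) ^ (ε * (W.numSteps : ℝ)))) ^ d) *
          (W.encode.length : ℝ) ^ e := by
  obtain ⟨δ, hδ, hδ'⟩ := hETH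
  -- As `(δ / 12) * (6 * n + 1) ≤ (δ / 2) * (n + 1)`, the solver uses half of the exponent `δ` and
  -- the other half is kept for polynomial factors.
  refine ⟨δ / 12, by positivity, fun C d e h => ?_⟩
  -- Degree `4` covers the overhead of the reduction, `d` the logarithms, and `4 * e` the `e`-th
  -- power of the instance size.
  obtain ⟨B, hB, hpow⟩ := pow_le_mul_two_rpow (half_pos hδ) (4 + d + 4 * e)
  -- The factor `2 ^ δ` pays for working with `x = n + 1` in place of `n`.
  refine hδ' ((3017 + |C| * (1 + δ) ^ d * 1000 ^ e) * B * (2 : ℝ) ^ δ)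
    (h.solvableWithin_cnf3.mono fun φ => ?_)
  set x : ℝ := (φ.numVars : ℝ) + 1 with hx
  have hx1 : 1 ≤ x := by simp [hx]
  have hx0 : 0 ≤ x := by linarith
  have hk : (φ.toWorkflow.numSteps : ℝ) = 6 * x - 5 := by
    change ((6 * φ.numVars + 1 : ℕ) : ℝ) = _
    push_cast
    linarith
  have hexp : δ / 12 * (φ.toWorkflow.numSteps : ℝ) ≤ δ / 2 * x := by
    rw [hk]
    linarith
  have hnn : 0 ≤ δ / 12 * (φ.toWorkflow.numSteps : ℝ) := by positivity
  set T : ℝ := (2 : ℝ) ^ (δ / 2 * x) with hT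
  have hT1 : 1 ≤ T := Real.one_le_rpow one_le_two (by positivity)
  have h₁ : (2 : ℝ) ^ (δ / 12 * (φ.toWorkflow.numSteps : ℝ)) ≤ T :=
    Real.rpow_le_rpow_of_exponent_le one_le_two hexp
  have hlog : Real.log ((2 : ℝ) ^ (δ / 12 * (φ.toWorkflow.numSteps : ℝ))) =
      δ / 12 * (φ.toWorkflow.numSteps : ℝ) * Real.log 2 := Real.log_rpow two_pos _
  have hlog2 : Real.log 2 ≤ 1 := by linarith [Real.log_two_lt_d9]
  have hlog0 : 0 ≤ Real.log 2 := Real.log_nonneg one_le_two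
  have h₂ : 1 + Real.log ((2 : ℝ) ^ (δ / 12 * (φ.toWorkflow.numSteps : ℝ))) ≤ (1 + δ) * x := by
    rw [hlog]
    have := mul_le_mul_of_nonneg_left hlog2 hnn
    nlinarith
  have h₂' : 0 ≤ 1 + Real.log ((2 : ℝ) ^ (δ / 12 * (φ.toWorkflow.numSteps : ℝ))) := by
    rw [hlog]
    positivity
  have h₃ : (φ.toWorkflow.encode.length : ℝ) ≤ 1000 * x ^ 4 := by
    rw [hx]
    exact_mod_cast φ.length_encode_toWorkflow_le
  have htime : C * ((2 : ℝ) ^ (δ / 12 * (φ.toWorkflow.numSteps : ℝ)) *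
      (1 + Real.log ((2 : ℝ) ^ (δ / 12 * (φ.toWorkflow.numSteps : ℝ)))) ^ d) *
        (φ.toWorkflow.encode.length : ℝ) ^ e ≤
      |C| * (1 + δ) ^ d * 1000 ^ e * (x ^ (4 + d + 4 * e) * T) := by
    calc _ ≤ |C| * (T * ((1 + δ) * x) ^ d) * (1000 * x ^ 4) ^ e := by
          gcongr
          exact le_abs_self C
      _ = |C| * (1 + δ) ^ d * 1000 ^ e * (x ^ (d + 4 * e) * T) := by
          rw [mul_pow (1 + δ), mul_pow 1000, ← pow_mul, pow_add]
          ring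
      _ ≤ _ := by
          gcongr ?_ * (?_ * T)
          exact pow_le_pow_right₀ hx1 (by lia)
  have hpoly : 3017 * x ^ 4 ≤ 3017 * (x ^ (4 + d + 4 * e) * T) := by
    have : x ^ 4 ≤ x ^ (4 + d + 4 * e) := pow_le_pow_right₀ hx1 (by lia)
    nlinarith [pow_nonneg hx0 (4 + d + 4 * e)]
  have hTT : T * T = (2 : ℝ) ^ δ * (2 : ℝ) ^ (δ * (φ.numVars : ℝ)) := by
    rw [hT, ← Real.rpow_add two_pos, ← Real.rpow_add two_pos, hx]
    ring_nf
  calc _ ≤ (3017 + |C| * (1 + δ) ^ d * 1000 ^ e) * (x ^ (4 + d + 4 * e) * T) := by linarith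
    _ ≤ (3017 + |C| * (1 + δ) ^ d * 1000 ^ e) * (B * T * T) := by
        gcongr
        exact hpow x hx0
    _ = _ := by
        rw [mul_assoc B, hTT]
        ring
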